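/- **Setting.** Let $\{W_n\}_{n\ge 1}$ be a time-homogeneous Markov chain, with an arbitrary initial law, in a measurable space $\mathcal W$, and let $H:\mathbb R^{d_1}\times\mathbb R^{d_2}\times\mathcal W\to\mathbb R^{d_1}$, $G:\mathbb R^{d_1}\times\mathbb R^{d_2}\times\mathcal W\to\mathbb R^{d_2}$. From arbitrary (possibly random) $x_0\in\mathbb R^{d_1}$, $y_0\in\mathbb R^{d_2}$ define, for $n\ge 0$, $$x_{n+1}=x_n+\alpha(n)H(x_n,y_n,W_{n+1}),\qquad y_{n+1}=y_n+\beta(n)G(x_n,y_n,W_{n+1}).$$ For $F\in\{H,G\}$ and $c\ge 1$ put $F_c(x,y,w)=F(cx,cy,w)/c$. Norms are Euclidean. Assume: 1. The transition kernel of $\{W_n\}$ has a unique invariant probability measure $d_{\mathcal W}$. 2. $\alpha(i),\beta(i)$ are positive and decreasing (not necessarily strictly), $\sum_i\alpha(i)=\sum_i\beta(i)=\infty$, $\alpha(i)\to0$, $\beta(i)\to 0$, $\frac{\alpha(i)-\alpha(i+1)}{\alpha(i)}=\mathcal O(\alpha(i))$, $\frac{\beta(i)-\beta(i+1)}{\beta(i)}=\mathcal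 O(\beta(i))$, and $\beta(i)/\alpha(i)\to0$. 3. There are measurable functions $H_\infty,G_\infty,b_H,b_G$ of $(x,y,w)$, functions $\kappa_H,\kappa_G:\mathbb R\to\mathbb R$ and a measurable $L_b:\mathcal W\to\mathbb R$ with $\mathbb E_{w\sim d_{\mathcal W}}[L_b(w)]$ well defined and finite such that for $F\in\{H,G\}$, all $c\ge 1$ and all $x,x',y,y',w$: $F_c(x,y,w)-F_\infty(x,y,w)=\kappa_F(c)\,b_F(x,y,w)$, $\lim_{c\to\infty}\kappa_F(c)=0$, and $\|b_F(x,y,w)-b_F(x',y',w)\|\le L_b(w)\|(x,y)-(x',y')\|$. 4. There is a measurable $L:\mathcal W\to\mathbb R$ with $\mathbb E_{w\sim d_{\mathcal W}}[L(w)]$ well defined and finite such that $H,G,H_\infty,G_\infty$ are, for each $w$, Lipschitz in $(x,y)$ with constant $L(w)$; and for all $x,y$ the expectations $h(x,y)=\mathbb E_{d_{\mathcal W}}[H(x,y,w)]$, $h_\infty(x,y)=\mathbb E_{d_{\mathcal W}}[H_\infty(x,y,w)]$, $g(x,y)=\mathbb E_{d_{\mathcal W}}[G(x,y,w)]$, $g_\infty(x,y)=\mathbb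 E_{d_{\mathcal W}}[G_\infty(x,y,w)]$ are well defined and finite. 5. For every $y\in\mathbb R^{d_2}$ the ODE $\dot x=h(x,y)$ has a unique globally asymptotically stable equilibrium $\lambda(y)$, with $\lambda$ Lipschitz, and $\dot y=g(\lambda(y),y)$ has a unique globally asymptotically stable equilibrium. As $c\to\infty$, $h(cx,cy)/c\to h_\infty(x,y)$ and $g(cx,cy)/c\to g_\infty(x,y)$ uniformly on compact subsets of $\mathbb R^{d_1+d_2}$. For every $y$ the ODE $\dot x=h_\infty(x,y)$ has a unique globally asymptotically stable equilibrium $\lambda_\infty(y)$, where $\lambda_\infty$ is Lipschitz, $\lambda_\infty(cy)=c\lambda_\infty(y)$ for all $c>0$, and $\lambda_\infty(0)=0$; and $\dot y=g_\infty(\lambda_\infty(y),y)$ has $0$ as its unique globally asymptotically stable equilibrium. 6. On one event of probability one, for every $\gamma$ among the functions $w\mapsto H(x,y,w)$, $w\mapsto G(x,y,w)$ (all $x,y$), $L_b$ and $L$, $$\lim_{n\to\infty}\alpha(n)\sum_{i=1}^n\bigl(\gamma(W_i)-\mathbb E_{d_{\mathcal W}}[\gamma]\bigr)=0,\qquad \lim_{n\to\infty}\beta(n)\sum_{i=1}^n\bigl(\gamma(W_i)-\mathbb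 E_{d_{\mathcal W}}[\gamma]\bigr)=0 .$$ **Lemma 3.1.** Almost surely there is a sample-path-dependent constant $K$ such that for all $n$ $$\|x_n\|\le K\,(1+\|y_n^{\max}\|),$$ where $y_n^{\max}=y_m$ for any $m\in\arg\max_{i\le n}\|y_i\|$ (ties broken arbitrarily). -/

import Mathlib

open Filter Topology MeasureTheory ProbabilityTheory Asymptotics

namespace TwoTimescale

/-- The Euclidean space `ℝ^d`. -/
abbrev Euc (d : ℕ) : Type := EuclideanSpace ℝ (Fin d)

/-- The Euclidean norm of the concatenation `(x, y) ∈ ℝ^(d₁ + d₂)`. -/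
noncomputable def pairNorm {d₁ d₂ : ℕ} (x : Euc d₁) (y : Euc d₂) : ℝ :=
  ‖(WithLp.toLp 2 (x, y) : WithLp 2 (Euc d₁ × Euc d₂))‖

/-- The pair `(x_n, y_n)` generated from `(x_0, y_0)` and the noise sequence `w_1, w_2, …` by
`x_{n+1} = x_n + α(n) H(x_n, y_n, w_{n+1})` and `y_{n+1} = y_n + β(n) G(x_n, y_n, w_{n+1})`.
The entry `w 0` is never used. -/
noncomputable def iterates {d₁ d₂ : ℕ} {𝒲 : Type*}
    (H : Euc d₁ → Euc d₂ → 𝒲 → Euc d₁) (G : Euc d₁ → Euc d₂ → 𝒲 → Euc d₂)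
    (α β : ℕ → ℝ) (x₀ : Euc d₁) (y₀ : Euc d₂) (w : ℕ → 𝒲) : ℕ → Euc d₁ × Euc d₂
  | 0 => (x₀, y₀)
  | n + 1 =>
    let z := iterates H G α β x₀ y₀ w n
    (z.1 + α n • H z.1 z.2 (w (n + 1)), z.2 + β n • G z.1 z.2 (w (n + 1)))

/-- The fast iterate `x_n`. -/
noncomputable def fastIter {d₁ d₂ : ℕ} {𝒲 : Type*}
    (H : Euc d₁ → Euc d₂ → 𝒲 → Euc d₁) (G : Euc d₁ → Euc d₂ → 𝒲 → Euc d₂)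
    (α β : ℕ → ℝ) (x₀ : Euc d₁) (y₀ : Euc d₂) (w : ℕ → 𝒲) (n : ℕ) : Euc d₁ :=
  (iterates H G α β x₀ y₀ w n).1

/-- The slow iterate `y_n`. -/
noncomputable def slowIter {d₁ d₂ : ℕ} {𝒲 : Type*}
    (H : Euc d₁ → Euc d₂ → 𝒲 → Euc d₁) (G : Euc d₁ → Euc d₂ → 𝒲 → Euc d₂)
    (α β : ℕ → ℝ) (x₀ : Euc d₁) (y₀ : Euc d₂) (w : ℕ → 𝒲) (n : ℕ) : Euc d₂ :=
  (iterates H G α β x₀ y₀ w n).2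

/-- `m ∈ argmax_{i ≤ n} ‖y_i‖`. -/
def IsArgmaxNorm {V : Type*} [Norm V] (y : ℕ → V) (n m : ℕ) : Prop :=
  m ≤ n ∧ ∀ i ≤ n, ‖y i‖ ≤ ‖y m‖

/-- The σ-algebra generated by `W_1, …, W_n`. -/
@[reducible]
def pastSigma {Ω 𝒲 : Type*} [MeasurableSpace 𝒲] (W : ℕ → Ω → 𝒲) (n : ℕ) :
    MeasurableSpace Ω :=
  ⨆ i ∈ Finset.Icc 1 n, MeasurableSpace.comap (W i) inferInstance

/-- `W_1, W_2, …` is a time-homogeneous Markov chain under `μ` with transition kernel `P`, with an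
arbitrary law of `W_1`: `μ(W_{n+1} ∈ A | W_1, …, W_n) = P(W_n, A)` almost surely. -/
structure IsMarkovChain {Ω 𝒲 : Type*} [MeasurableSpace Ω] [MeasurableSpace 𝒲]
    (μ : Measure Ω) (P : Kernel 𝒲 𝒲) (W : ℕ → Ω → 𝒲) : Prop where
  measurable : ∀ n, 1 ≤ n → Measurable (W n)
  markov : ∀ n, 1 ≤ n → ∀ A : Set 𝒲, MeasurableSet A →
    μ⟦W (n + 1) ⁻¹' A | pastSigma W n⟧ =ᵐ[μ] fun ω => (P (W n ω)).real A

/-- `d` is the unique invariant probability measure of the kernel `P`. -/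
structure IsUniqueInvariant {𝒲 : Type*} [MeasurableSpace 𝒲]
    (P : Kernel 𝒲 𝒲) (d : Measure 𝒲) : Prop where
  isProbabilityMeasure : IsProbabilityMeasure d
  invariant : P.Invariant d
  unique : ∀ d' : Measure 𝒲, IsProbabilityMeasure d' → P.Invariant d' → d' = d

/-- Conditions on a single learning-rate sequence. -/
structure IsLearningRate (a : ℕ → ℝ) : Prop where
  pos : ∀ i, 0 < a i
  decreasing : Antitone a
  sum_eq_infty : Tendsto (fun n => ∑ i ∈ Finset.range n, a i) atTop atTop
  tendsto_zero : Tendsto a atTop (𝓝 0)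
  ratio : (fun i => (a i - a (i + 1)) / a i) =O[atTop] a

/-- Conditions on the pair of learning rates (`α` fast, `β` slow). -/
structure LearningRates (α β : ℕ → ℝ) : Prop where
  fast : IsLearningRate α
  slow : IsLearningRate β
  separation : Tendsto (fun i => β i / α i) atTop (𝓝 0)

/-- The rescaling `F_c(x, y) = F(c x, c y) / c`. -/
noncomputable def rescale {d₁ d₂ : ℕ} {V : Type*} [AddCommGroup V] [Module ℝ V]
    (F : Euc d₁ → Euc d₂ → V) (c : ℝ) (x : Euc d₁) (y : Euc d₂) : V :=
  c⁻¹ • F (c • x) (c • y)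

/-- The mean `f(x, y) = E_{w ∼ d}[F(x, y, w)]`. -/
noncomputable def mean {d₁ d₂ : ℕ} {𝒲 V : Type*} [MeasurableSpace 𝒲]
    [NormedAddCommGroup V] [NormedSpace ℝ V]
    (d : Measure 𝒲) (F : Euc d₁ → Euc d₂ → 𝒲 → V) (x : Euc d₁) (y : Euc d₂) : V :=
  ∫ w, F x y w ∂d

/-- The condition on one increment function `F` (`H` or `G`) on how `F_c` approaches `F_∞`:
`F_c - F_∞ = κ(c) b` for `c ∈ [1, ∞)`, `κ(c) → 0`, and `b(·, ·, w)` is `L_b(w)`-Lipschitz. -/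
structure ScalingLimit {d₁ d₂ k : ℕ} {𝒲 : Type*} [MeasurableSpace 𝒲]
    (F Finf : Euc d₁ → Euc d₂ → 𝒲 → Euc k) (κ : ℝ → ℝ)
    (b : Euc d₁ → Euc d₂ → 𝒲 → Euc k) (Lb : 𝒲 → ℝ) : Prop where
  measurable_limit : Measurable fun p : Euc d₁ × Euc d₂ × 𝒲 => Finf p.1 p.2.1 p.2.2
  measurable_b : Measurable fun p : Euc d₁ × Euc d₂ × 𝒲 => b p.1 p.2.1 p.2.2
  eq : ∀ c : ℝ, 1 ≤ c → ∀ x y w,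
    rescale (fun x' y' => F x' y' w) c x y - Finf x y w = κ c • b x y w
  tendsto_zero : Tendsto κ atTop (𝓝 0)
  lipschitz : ∀ x x' y y' w, ‖b x y w - b x' y' w‖ ≤ Lb w * pairNorm (x - x') (y - y')

/-- One increment function `F` (`H` or `G`) and its limit `F_∞` are `L(w)`-Lipschitz in `(x, y)`
and have finite expectations under `d`. -/
structure LipschitzIncrement {d₁ d₂ k : ℕ} {𝒲 : Type*} [MeasurableSpace 𝒲] (d : Measure 𝒲)
    (F Finf : Euc d₁ → Euc d₂ → 𝒲 → Euc k) (L : 𝒲 → ℝ) : Prop where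
  lipschitz : ∀ x x' y y' w, ‖F x y w - F x' y' w‖ ≤ L w * pairNorm (x - x') (y - y')
  lipschitz_limit : ∀ x x' y y' w,
    ‖Finf x y w - Finf x' y' w‖ ≤ L w * pairNorm (x - x') (y - y')
  integrable : ∀ x y, Integrable (F x y) d
  integrable_limit : ∀ x y, Integrable (Finf x y) d

/-- `u : [0, ∞) → V` solves the autonomous ODE `u'(t) = f(u(t))`. -/
def IsODESolution {V : Type*} [NormedAddCommGroup V] [NormedSpace ℝ V]
    (f : V → V) (u : ℝ → V) : Prop :=
  ∀ t : ℝ, 0 ≤ t → HasDerivWithinAt u (f (u t)) (Set.Ici 0) t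

/-- `p` is a globally asymptotically stable equilibrium of `u' = f(u)`: an equilibrium that is
Lyapunov stable and attracts every solution. -/
structure IsGASEquilibrium {V : Type*} [NormedAddCommGroup V] [NormedSpace ℝ V]
    (f : V → V) (p : V) : Prop where
  equilibrium : f p = 0
  stable : ∀ ε > 0, ∃ δ > 0, ∀ u : ℝ → V, IsODESolution f u → ‖u 0 - p‖ < δ →
    ∀ t : ℝ, 0 ≤ t → ‖u t - p‖ < ε
  attractive : ∀ u : ℝ → V, IsODESolution f u → Tendsto u atTop (𝓝 p)

/-- `p` is the unique globally asymptotically stable equilibrium of `u' = f(u)`. -/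
structure IsUniqueGASEquilibrium {V : Type*} [NormedAddCommGroup V] [NormedSpace ℝ V]
    (f : V → V) (p : V) : Prop where
  gas : IsGASEquilibrium f p
  unique : ∀ q, IsGASEquilibrium f q → q = p

/-- As `c → ∞`, `f_c → f_∞` uniformly on compact subsets of `ℝ^d₁ × ℝ^d₂`. -/
def RescaledTendsto {d₁ d₂ : ℕ} {V : Type*} [NormedAddCommGroup V] [NormedSpace ℝ V]
    (f finf : Euc d₁ → Euc d₂ → V) : Prop :=
  ∀ B : Set (Euc d₁ × Euc d₂), IsCompact B →
    TendstoUniformlyOn (fun (c : ℝ) (z : Euc d₁ × Euc d₂) => rescale f c z.1 z.2)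
      (fun z => finf z.1 z.2) atTop B

/-- The conditions on the mean ODEs. -/
structure ODEConditions {d₁ d₂ : ℕ}
    (h hinf : Euc d₁ → Euc d₂ → Euc d₁) (g ginf : Euc d₁ → Euc d₂ → Euc d₂)
    (lam laminf : Euc d₂ → Euc d₁) : Prop where
  lam_lipschitz : ∃ C, LipschitzWith C lam
  fast_gas : ∀ y, IsUniqueGASEquilibrium (fun x => h x y) (lam y)
  slow_gas : ∃ ystar, IsUniqueGASEquilibrium (fun y => g (lam y) y) ystar
  fast_tendsto : RescaledTendsto h hinf
  laminf_lipschitz : ∃ C, LipschitzWith C laminf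
  fast_gas_limit : ∀ y, IsUniqueGASEquilibrium (fun x => hinf x y) (laminf y)
  laminf_homogeneous : ∀ c : ℝ, 0 < c → ∀ y, laminf (c • y) = c • laminf y
  laminf_zero : laminf 0 = 0
  slow_tendsto : RescaledTendsto g ginf
  slow_gas_limit : IsUniqueGASEquilibrium (fun y => ginf (laminf y) y) 0

/-- Along the noise path `w_1, w_2, …`, `a(n) ∑_{i=1}^n (γ(w_i) - E_d[γ]) → 0`. -/
def AveragesOut {𝒲 V : Type*} [MeasurableSpace 𝒲] [NormedAddCommGroup V] [NormedSpace ℝ V]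
    (d : Measure 𝒲) (a : ℕ → ℝ) (w : ℕ → 𝒲) (γ : 𝒲 → V) : Prop :=
  Tendsto (fun n : ℕ => a n • ∑ i ∈ Finset.Icc 1 n, (γ (w i) - ∫ v, γ v ∂d)) atTop (𝓝 0)

/-- `AveragesOut` with the rate `a` for every function that the averaging condition lists. -/
structure NoiseAverages {d₁ d₂ : ℕ} {𝒲 : Type*} [MeasurableSpace 𝒲] (d : Measure 𝒲)
    (H : Euc d₁ → Euc d₂ → 𝒲 → Euc d₁) (G : Euc d₁ → Euc d₂ → 𝒲 → Euc d₂)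
    (Lb L : 𝒲 → ℝ) (a : ℕ → ℝ) (w : ℕ → 𝒲) : Prop where
  fast : ∀ x y, AveragesOut d a w (H x y)
  slow : ∀ x y, AveragesOut d a w (G x y)
  lipschitz_b : AveragesOut d a w Lb
  lipschitz : AveragesOut d a w L

end TwoTimescale

namespace TwoTimescale

/-! Measure time by the fast clock, on which step `i` lasts `α i`; since `β/α → 0`, the slow iterate
is almost frozen there. Suppose that the fast iterate dominates at step `n`, i.e. `‖x n‖ ≥ K (1 + ‖y
n‖)`, and divide everything by `‖x n‖`. The scaled slow iterate is then close to `0`, and the scaled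
fast one nearly follows `u' = h_∞(u, 0)`, whose solutions all tend to `λ_∞(0) = 0`. Once the
solution has norm at most `1/2`, the fast iterate is back below `‖x n‖`, after an excursion of size
at most `R ‖x n‖` (`exists_descent`). If the fast iterate does not dominate, one step keeps it of
order `1 + ‖y n‖` (`exists_one_step_le`). So a bound by a multiple of `1 + max_{i ≤ n} ‖y i‖` recurs
forever, with controlled excursions in between (`forall_le_mul_of_recurrent`).

The tracking estimate `eventually_rescaled_close` compares the iterates with one solution fixed
before `n`. The noise therefore only has to be small along a fixed continuous curve: summation by
parts handles a frozen argument, and freezing the curve on a finite grid handles the rest.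
Compactness of the unit sphere leaves finitely many solutions to follow, so no uniform attraction
time is needed. -/

/-- The time `∑_{n ≤ i < k} a(i)` that elapses between the steps `n` and `k`. -/
def elapsed (a : ℕ → ℝ) (n k : ℕ) : ℝ := ∑ i ∈ Finset.Ico n k, a i

@[simp] theorem elapsed_self (a : ℕ → ℝ) (n : ℕ) : elapsed a n n = 0 := by
  simp [elapsed]

theorem elapsed_succ (a : ℕ → ℝ) {n k : ℕ} (h : n ≤ k) :
    elapsed a n (k + 1) = elapsed a n k + a k :=
  Finset.sum_Ico_succ_top h a

theorem elapsed_mono {a : ℕ → ℝ} (ha : ∀ i, 0 ≤ a i) (n : ℕ) : Monotone (elapsed a n) :=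
  fun _ _ h => Finset.sum_le_sum_of_subset_of_nonneg (Finset.Ico_subset_Ico_right h)
    fun i _ _ => ha i

theorem elapsed_nonneg {a : ℕ → ℝ} (ha : ∀ i, 0 ≤ a i) (n k : ℕ) : 0 ≤ elapsed a n k :=
  Finset.sum_nonneg fun i _ => ha i

/-! ### Noise and Grönwall estimates over windows of bounded elapsed time -/

section Windows

variable {E V : Type*} [NormedAddCommGroup E] [NormedSpace ℝ E] [NormedAddCommGroup V]

/-- Summation by parts over a window. -/
theorem window_sum_by_parts (a : ℕ → ℝ) (S : ℕ → E) {n k : ℕ} (h : n ≤ k) :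
    ∑ i ∈ Finset.Ico n k, a i • (S (i + 1) - S i) =
      a k • S k - a n • S n + ∑ i ∈ Finset.Ico n k, (a i - a (i + 1)) • S (i + 1) := by
  induction k, h using Nat.le_induction with
  | base => simp
  | succ k hk ih =>
    rw [Finset.sum_Ico_succ_top hk, Finset.sum_Ico_succ_top hk, ih]
    module

/-- Noise that averages out at the rate `a` is negligible over windows of bounded length. -/
theorem eventually_norm_window_sum_le {a : ℕ → ℝ} (ha : IsLearningRate a) {ξ : ℕ → E}
    (hξ : Tendsto (fun n => a n • ∑ i ∈ Finset.Icc 1 n, ξ i) atTop (𝓝 0)) (T : ℝ) {ε : ℝ}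
    (hε : 0 < ε) :
    ∀ᶠ n in atTop, ∀ k, n ≤ k → elapsed a n k ≤ T →
      ‖∑ i ∈ Finset.Ico n k, a i • ξ (i + 1)‖ ≤ ε := by
  obtain ⟨C, hC0, hC⟩ := ha.ratio.exists_pos
  rw [IsBigOWith] at hC
  set S : ℕ → E := fun n => ∑ i ∈ Finset.Icc 1 n, ξ i with hS
  have hSs : ∀ i, ξ (i + 1) = S (i + 1) - S i := fun i => by
    simp only [hS]; rw [Finset.sum_Icc_succ_top (by omega)]; abel
  -- Budget: the two boundary terms cost `η` each, the sum of increments of `a` costs `2 * C * η *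
  -- |T|`.
  set η := ε / (2 + 2 * C * |T|) with hη
  have hden : 0 < 2 + 2 * C * |T| := by positivity
  have hη0 : 0 < η := by positivity
  have h1 : ∀ᶠ n in atTop, ‖a n • S n‖ ≤ η := by
    have := hξ.norm
    rw [norm_zero] at this
    exact this.eventually (ge_mem_nhds hη0)
  have h2 : ∀ᶠ n in atTop, C * a n ≤ 1 / 2 := by
    have := ha.tendsto_zero.const_mul C
    rw [mul_zero] at this
    exact this.eventually (ge_mem_nhds (by norm_num))
  filter_upwards [eventually_forall_ge_atTop.2 (h1.and (h2.and hC))] with n hn k hk hT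
  have hstep : ∀ i, n ≤ i → ‖(a i - a (i + 1)) • S (i + 1)‖ ≤ 2 * C * η * a i := by
    intro i hi
    have hai := ha.pos i
    have hC' := (hn i hi).2.2
    have hCi := (hn i hi).2.1
    have hd : 0 ≤ a i - a (i + 1) := sub_nonneg.2 (ha.decreasing (Nat.le_succ i))
    rw [Real.norm_of_nonneg (by positivity), Real.norm_of_nonneg hai.le, div_le_iff₀ hai] at hC'
    -- The ratio condition gives `a i - a (i + 1) ≤ C * a i ^ 2`. Trading one factor `a i` for `2 *
    -- a (i + 1)` produces the small quantity `a (i + 1) * ‖S (i + 1)‖`.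
    have h2a : a i ≤ 2 * a (i + 1) := by nlinarith
    have hs := (hn (i + 1) (by omega)).1
    rw [norm_smul, Real.norm_of_nonneg (ha.pos _).le] at hs
    rw [norm_smul, Real.norm_of_nonneg hd]
    calc (a i - a (i + 1)) * ‖S (i + 1)‖ ≤ C * a i * a i * ‖S (i + 1)‖ := by gcongr
      _ ≤ C * a i * (2 * a (i + 1)) * ‖S (i + 1)‖ := by gcongr
      _ = 2 * C * a i * (a (i + 1) * ‖S (i + 1)‖) := by ring
      _ ≤ 2 * C * a i * η := by gcongr
      _ = _ := by ring
  simp only [hSs]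
  rw [window_sum_by_parts a S hk]
  have hsum : ‖∑ i ∈ Finset.Ico n k, (a i - a (i + 1)) • S (i + 1)‖ ≤ 2 * C * η * |T| := by
    calc _ ≤ ∑ i ∈ Finset.Ico n k, 2 * C * η * a i :=
          norm_sum_le_of_le _ fun i hi => hstep i (Finset.mem_Ico.1 hi).1
      _ = 2 * C * η * elapsed a n k := by rw [← Finset.mul_sum, elapsed]
      _ ≤ _ := by gcongr; exact hT.trans (le_abs_self T)
  calc _ ≤ ‖a k • S k‖ + ‖a n • S n‖ + ‖∑ i ∈ Finset.Ico n k, (a i - a (i + 1)) • S (i + 1)‖ :=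
        (norm_add_le _ _).trans (by gcongr; exact norm_sub_le _ _)
    _ ≤ η + η + 2 * C * η * |T| := by
        gcongr
        · exact (hn k hk).1
        · exact (hn n le_rfl).1
    _ = η * (2 + 2 * C * |T|) := by ring
    _ = ε := div_mul_cancel₀ _ hden.ne'

/-- The frozen-noise estimate concerns windows that start at `n`. Steps in cells below `j` form such
a window, so a single cell is a difference of two of them. -/
theorem exists_filter_lt_eq_Ico {c : ℕ → ℕ} (hc : Monotone c) (j : ℕ) {n k : ℕ} (h : n ≤ k) :
    ∃ k', n ≤ k' ∧ k' ≤ k ∧ (Finset.Ico n k).filter (fun i => c i < j) = Finset.Ico n k' := by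
  induction k, h using Nat.le_induction with
  | base => exact ⟨n, le_rfl, le_rfl, by simp⟩
  | succ k hk ih =>
    by_cases hck : c k < j
    · refine ⟨k + 1, by omega, le_rfl, Finset.filter_true_of_mem fun i hi => ?_⟩
      exact (hc (Nat.lt_succ_iff.1 (Finset.mem_Ico.1 hi).2)).trans_lt hck
    · obtain ⟨k', h1, h2, h3⟩ := ih
      refine ⟨k', h1, by omega, ?_⟩
      rw [← h3, ← Finset.insert_Ico_right_eq_Ico_add_one hk, Finset.filter_insert, if_neg hck]

/-- Noise `ξ x` that averages out for every frozen `x` and is Lipschitz in `x` is negligible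
along a continuous curve `u`, uniformly over the windows of length at most `T`. -/
theorem eventually_norm_window_sum_curve_le {a : ℕ → ℝ} (ha : IsLearningRate a) {ξ : V → ℕ → E}
    (hξ : ∀ x, Tendsto (fun n => a n • ∑ i ∈ Finset.Icc 1 n, ξ x i) atTop (𝓝 0))
    {Λ : ℕ → ℝ} (hΛ : ∀ x x' i, ‖ξ x i - ξ x' i‖ ≤ Λ i * ‖x - x'‖) (hΛ0 : ∀ i, 0 ≤ Λ i)
    {T Q : ℝ} (hT : 0 < T)
    (hQ : ∀ᶠ n in atTop, ∀ k, n ≤ k → elapsed a n k ≤ T →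
      ∑ i ∈ Finset.Ico n k, a i * Λ (i + 1) ≤ Q)
    {u : ℝ → V} (hu : ContinuousOn u (Set.Icc 0 T)) {ε : ℝ} (hε : 0 < ε) :
    ∀ᶠ n in atTop, ∀ k, n ≤ k → elapsed a n k ≤ T →
      ‖∑ i ∈ Finset.Ico n k, a i • ξ (u (elapsed a n i)) (i + 1)‖ ≤ ε := by
  have ha0 : ∀ i, 0 ≤ a i := fun i => (ha.pos i).le
  have huc := isCompact_Icc.uniformContinuousOn_of_continuous hu
  rw [Metric.uniformContinuousOn_iff_le] at huc
  obtain ⟨δ, hδ, huδ⟩ := huc (ε / (2 * (|Q| + 1))) (by positivity)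
  obtain ⟨N, hN⟩ := exists_nat_gt (T / δ)
  have hN0 : (0 : ℝ) < N := lt_of_le_of_lt (by positivity) hN
  set r := T / N with hr
  have hr0 : 0 < r := by positivity
  have hrδ : r ≤ δ := by
    rw [hr, div_le_iff₀ hN0]; rw [div_lt_iff₀ hδ] at hN; nlinarith
  -- There are `N + 1` cells, the last one for elapsed time exactly `T`; each costs `2 * ε'`, in
  -- total `ε / 2`. The other half pays for freezing the curve.
  set ε' := ε / (4 * (N + 1)) with hε'
  have hε'0 : 0 < ε' := by positivity
  have hfroz : ∀ᶠ n in atTop, ∀ j ∈ Finset.range (N + 1), ∀ k, n ≤ k → elapsed a n k ≤ T →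
      ‖∑ i ∈ Finset.Ico n k, a i • ξ (u (j * r)) (i + 1)‖ ≤ ε' :=
    (Filter.eventually_all_finset _).2 fun j _ =>
      eventually_norm_window_sum_le ha (hξ (u (j * r))) T hε'0
  filter_upwards [hfroz, hQ] with n hn hQn k hk hkT
  set t : ℕ → ℝ := elapsed a n with ht
  have ht0 : ∀ i, 0 ≤ t i := elapsed_nonneg ha0 n
  set c : ℕ → ℕ := fun i => ⌊t i / r⌋₊ with hc
  have hcm : Monotone c := fun i j hij =>
    Nat.floor_mono (div_le_div_of_nonneg_right (elapsed_mono ha0 n hij) hr0.le)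
  have htT : ∀ i ∈ Finset.Ico n k, t i ≤ T := fun i hi =>
    (elapsed_mono ha0 n (Finset.mem_Ico.1 hi).2.le).trans hkT
  have hcN : ∀ i ∈ Finset.Ico n k, c i ∈ Finset.range (N + 1) := fun i hi => by
    rw [Finset.mem_range, Nat.lt_succ_iff]
    refine Nat.floor_le_of_le ?_
    rw [div_le_iff₀ hr0, hr, mul_div_cancel₀ _ hN0.ne']
    exact htT i hi
  have hcell : ∀ j ∈ Finset.range (N + 1),
      ‖∑ i ∈ Finset.Ico n k with c i = j, a i • ξ (u (c i * r)) (i + 1)‖ ≤ 2 * ε' := by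
    intro j hj
    set F : ℕ → E := fun i => a i • ξ (u (j * r)) (i + 1) with hF
    have e1 : ∑ i ∈ Finset.Ico n k with c i = j, a i • ξ (u (c i * r)) (i + 1) =
        ∑ i ∈ Finset.Ico n k with c i = j, F i :=
      Finset.sum_congr rfl fun i hi => by rw [(Finset.mem_filter.1 hi).2]
    have e2 : ∑ i ∈ Finset.Ico n k with c i < j + 1, F i =
        ∑ i ∈ Finset.Ico n k with c i < j, F i + ∑ i ∈ Finset.Ico n k with c i = j, F i := by
      rw [← Finset.sum_union]
      · congr 1
        ext i
        simp only [Finset.mem_filter, Finset.mem_union]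
        have : c i < j + 1 ↔ c i < j ∨ c i = j := by omega
        rw [this]; tauto
      · refine Finset.disjoint_filter.2 fun i _ h h' => ?_
        omega
    have e3 : ∀ j', ‖∑ i ∈ Finset.Ico n k with c i < j', F i‖ ≤ ε' := by
      intro j'
      obtain ⟨k', h1, h2, h3⟩ := exists_filter_lt_eq_Ico hcm j' hk
      rw [h3]
      exact hn j hj k' h1 ((elapsed_mono ha0 n h2).trans hkT)
    rw [e1, ← sub_eq_of_eq_add' e2]
    exact (norm_sub_le _ _).trans (by linarith [e3 j, e3 (j + 1)])
  have hmain : ‖∑ i ∈ Finset.Ico n k, a i • ξ (u (c i * r)) (i + 1)‖ ≤ ε / 2 := by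
    rw [← Finset.sum_fiberwise_of_maps_to hcN]
    calc _ ≤ ∑ j ∈ Finset.range (N + 1), 2 * ε' := norm_sum_le_of_le _ hcell
      _ = ε / 2 := by
        rw [Finset.sum_const, Finset.card_range, nsmul_eq_mul, hε']; push_cast
        field_simp; norm_num
  have hdiff : ‖∑ i ∈ Finset.Ico n k, (a i • ξ (u (t i)) (i + 1) -
      a i • ξ (u (c i * r)) (i + 1))‖ ≤ ε / 2 := by
    calc _ ≤ ∑ i ∈ Finset.Ico n k, a i * Λ (i + 1) * (ε / (2 * (|Q| + 1))) := by
          refine norm_sum_le_of_le _ fun i hi => ?_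
          rw [← smul_sub, norm_smul, Real.norm_of_nonneg (ha0 i), mul_assoc]
          refine mul_le_mul_of_nonneg_left ((hΛ _ _ _).trans ?_) (ha0 i)
          refine mul_le_mul_of_nonneg_left ?_ (hΛ0 _)
          rw [← dist_eq_norm]
          have hfl : (c i : ℝ) * r ≤ t i := by
            rw [← le_div_iff₀ hr0]; exact Nat.floor_le (div_nonneg (ht0 i) hr0.le)
          have hfu : t i < (c i + 1 : ℝ) * r := by
            rw [← div_lt_iff₀ hr0]; exact Nat.lt_floor_add_one _
          refine huδ _ ⟨ht0 i, htT i hi⟩ _ ⟨by positivity, hfl.trans (htT i hi)⟩ ?_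
          rw [Real.dist_eq, abs_of_nonneg (by linarith)]
          nlinarith
      _ = (∑ i ∈ Finset.Ico n k, a i * Λ (i + 1)) * (ε / (2 * (|Q| + 1))) := by
          rw [Finset.sum_mul]
      _ ≤ (|Q| + 1) * (ε / (2 * (|Q| + 1))) := by
          gcongr
          exact (hQn k hk hkT).trans ((le_abs_self Q).trans (by linarith))
      _ = ε / 2 := by field_simp
  rw [Finset.sum_sub_distrib] at hdiff
  calc _ = ‖(∑ i ∈ Finset.Ico n k, a i • ξ (u (t i)) (i + 1) -
      ∑ i ∈ Finset.Ico n k, a i • ξ (u (c i * r)) (i + 1)) +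
      ∑ i ∈ Finset.Ico n k, a i • ξ (u (c i * r)) (i + 1)‖ := by rw [sub_add_cancel]
    _ ≤ ε / 2 + ε / 2 := norm_add_le_of_le hdiff hmain
    _ = ε := add_halves ε

/-- A discrete Grönwall inequality in summed form. -/
theorem le_mul_exp_of_le_add_window_sum {v c : ℕ → ℝ} {A : ℝ} (hA : 0 ≤ A) (hc : ∀ i, 0 ≤ c i) {n m : ℕ}
    (hv : ∀ k, n ≤ k → k ≤ m → v k ≤ A + ∑ i ∈ Finset.Ico n k, c i * v i) {k : ℕ} (hnk : n ≤ k)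
    (hkm : k ≤ m) : v k ≤ A * Real.exp (∑ i ∈ Finset.Ico n k, c i) := by
  -- The induction runs on the majorant, which is explicit in the earlier values, rather than on `v
  -- k`.
  refine (hv k hnk hkm).trans ?_
  induction k, hnk using Nat.le_induction with
  | base => simp
  | succ k hk ih =>
    rw [Finset.sum_Ico_succ_top hk, Finset.sum_Ico_succ_top hk, Real.exp_add]
    have h1 := ih (by omega)
    have h2 := hv k hk (by omega)
    have h3 := mul_le_mul_of_nonneg_left h2 (hc k)
    set B := A + ∑ i ∈ Finset.Ico n k, c i * v i with hB
    set X := A * Real.exp (∑ i ∈ Finset.Ico n k, c i) with hX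
    have h4 := Real.add_one_le_exp (c k)
    calc A + (∑ i ∈ Finset.Ico n k, c i * v i + c k * v k) = B + c k * v k := by rw [hB]; ring
      _ ≤ (1 + c k) * B := by linarith
      _ ≤ (1 + c k) * X := by gcongr; linarith [hc k]
      _ ≤ Real.exp (c k) * X := by
        have hX0 : 0 ≤ X := by positivity
        gcongr; linarith
      _ = _ := by rw [hX]; ring

theorem eq_add_window_sum_sub {A : Type*} [AddCommGroup A] (z : ℕ → A) {n k : ℕ} (h : n ≤ k) :
    z k = z n + ∑ i ∈ Finset.Ico n k, (z (i + 1) - z i) := by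
  induction k, h using Nat.le_induction with
  | base => simp
  | succ k hk ih => rw [Finset.sum_Ico_succ_top hk, ← add_assoc, ← ih]; abel

/-- Window sums of a sequence with a long-run average are bounded. -/
theorem eventually_norm_window_sum_le_of_mean {a : ℕ → ℝ} (ha : IsLearningRate a) {γ : ℕ → E}
    {m : E} (hγ : Tendsto (fun n => a n • ∑ i ∈ Finset.Icc 1 n, (γ i - m)) atTop (𝓝 0)) (T : ℝ) :
    ∀ᶠ n in atTop, ∀ k, n ≤ k → elapsed a n k ≤ T →
      ‖∑ i ∈ Finset.Ico n k, a i • γ (i + 1)‖ ≤ T * ‖m‖ + 1 := by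
  filter_upwards [eventually_norm_window_sum_le ha hγ T one_pos] with n hn k hk hT
  have e : ∑ i ∈ Finset.Ico n k, a i • γ (i + 1) =
      elapsed a n k • m + ∑ i ∈ Finset.Ico n k, a i • (γ (i + 1) - m) := by
    rw [elapsed, Finset.sum_smul, ← Finset.sum_add_distrib]
    exact Finset.sum_congr rfl fun i _ => by module
  rw [e]
  refine norm_add_le_of_le ?_ (hn k hk hT)
  rw [norm_smul, Real.norm_of_nonneg (elapsed_nonneg (fun i => (ha.pos i).le) n k)]
  gcongr

theorem tendsto_elapsed {a : ℕ → ℝ} (ha : IsLearningRate a) (n : ℕ) :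
    Tendsto (elapsed a n) atTop atTop := by
  have h : ∀ᶠ k in atTop, ∑ i ∈ Finset.range k, a i - ∑ i ∈ Finset.range n, a i =
      elapsed a n k := by
    filter_upwards [eventually_ge_atTop n] with k hk
    rw [elapsed, Finset.sum_Ico_eq_sub _ hk]
  exact (tendsto_atTop_add_const_right _ _ ha.sum_eq_infty).congr' h

/-- Once the steps are at most `1`, a window can be stopped in any given time interval of
length `1`. -/
theorem exists_elapsed_mem_Icc {a : ℕ → ℝ} (ha : IsLearningRate a) {n : ℕ}
    (hn : ∀ i, n ≤ i → a i ≤ 1) {T : ℝ} (hT : 0 < T) :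
    ∃ k, n < k ∧ T ≤ elapsed a n k ∧ elapsed a n k ≤ T + 1 := by
  classical
  have hex : ∃ k, T ≤ elapsed a n k := ((tendsto_elapsed ha n).eventually_ge_atTop T).exists
  set k := Nat.find hex with hk
  have hkT : T ≤ elapsed a n k := Nat.find_spec hex
  have hnk : n < k := by
    by_contra h
    rw [elapsed, Finset.Ico_eq_empty_of_le (not_lt.1 h), Finset.sum_empty] at hkT
    linarith
  refine ⟨k, hnk, hkT, ?_⟩
  obtain ⟨j, hj⟩ : ∃ j, k = j + 1 := ⟨k - 1, by omega⟩
  have hmin : elapsed a n j < T := not_le.1 (Nat.find_min hex (by omega))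
  rw [hj, elapsed_succ a (by omega)]
  linarith [hn j (by omega)]

end Windows

/-! ### Global solutions of Lipschitz ODEs and their Euler errors -/

section ODE

variable {E : Type*} [NormedAddCommGroup E] [NormedSpace ℝ E]

open scoped BoundedContinuousFunction

/-- The exponential weight gains a factor `1 / c` uniformly in `t`, which makes the Picard operator
a contraction on the whole half-line. -/
theorem norm_integral_exp_weight_le {φ : ℝ → E} {c B t : ℝ} (hc : 0 < c) (ht : 0 ≤ t)
    (hB : 0 ≤ B) (hφ : ∀ s, ‖φ s‖ ≤ B * Real.exp (c * s)) :
    ‖Real.exp (-(c * t)) • ∫ s in (0 : ℝ)..t, φ s‖ ≤ B / c := by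
  have h1 : ‖∫ s in (0 : ℝ)..t, φ s‖ ≤ ∫ s in (0 : ℝ)..t, B * Real.exp (c * s) :=
    intervalIntegral.norm_integral_le_of_norm_le ht (Eventually.of_forall fun s _ => hφ s)
      (Continuous.intervalIntegrable (by fun_prop) _ _)
  have h2 : ∫ s in (0 : ℝ)..t, B * Real.exp (c * s) = B / c * (Real.exp (c * t) - 1) := by
    rw [intervalIntegral.integral_const_mul, intervalIntegral.integral_comp_mul_left _ hc.ne',
      integral_exp]
    simp; ring
  rw [norm_smul, Real.norm_of_nonneg (Real.exp_pos _).le]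
  calc _ ≤ Real.exp (-(c * t)) * (B / c * (Real.exp (c * t) - 1)) := by
        rw [← h2]; gcongr
    _ = B / c * (1 - Real.exp (-(c * t))) := by
        have : Real.exp (-(c * t)) * Real.exp (c * t) = 1 := by rw [← Real.exp_add]; simp
        linear_combination (B / c) * this
    _ ≤ B / c := mul_le_of_le_one_right (by positivity) (by linarith [Real.exp_pos (-(c * t))])

/-- Global existence for an autonomous ODE with a Lipschitz vector field vanishing at `0`. -/
theorem exists_isODESolution [CompleteSpace E] {f : E → E} {ℓ : ℝ} (hℓ : 0 ≤ ℓ)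
    (hf : ∀ x y, ‖f x - f y‖ ≤ ℓ * ‖x - y‖) (hf0 : f 0 = 0) (x₀ : E) :
    ∃ u : ℝ → E, u 0 = x₀ ∧ IsODESolution f u := by
  have hfc : Continuous f := by
    refine (LipschitzWith.of_dist_le_mul (K := ⟨ℓ, hℓ⟩) fun x y => ?_).continuous
    rw [dist_eq_norm, dist_eq_norm]; exact hf x y
  -- With the unknown `v t = exp (-(c * t)) • u t`, the Picard operator has Lipschitz constant `ℓ /
  -- c ≤ 1 / 2`. Replacing `t` by `max t 0` below extends it constantly to negative times.
  set c : ℝ := 2 * ℓ + 1 with hc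
  have hc0 : 0 < c := by positivity
  let ψ : (ℝ →ᵇ E) → ℝ → E := fun v s => f (Real.exp (c * s) • v s)
  have hψc : ∀ v, Continuous (ψ v) := fun v => by
    have := v.continuous
    exact hfc.comp (by fun_prop)
  have hψi : ∀ v s t, IntervalIntegrable (ψ v) volume s t := fun v s t =>
    (hψc v).intervalIntegrable s t
  let I : (ℝ →ᵇ E) → ℝ → E := fun v t => ∫ s in (0 : ℝ)..(max t 0), ψ v s
  have hIc : ∀ v, Continuous (I v) := fun v =>
    (intervalIntegral.continuous_primitive (hψi v) 0).comp (by fun_prop)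
  let Φ : (ℝ →ᵇ E) → ℝ → E := fun v t => Real.exp (-(c * max t 0)) • (x₀ + I v t)
  have hdiff : ∀ v v' s, ‖ψ v s - ψ v' s‖ ≤ ℓ * ‖v - v'‖ * Real.exp (c * s) := fun v v' s => by
    refine (hf _ _).trans ?_
    rw [← smul_sub, norm_smul, Real.norm_of_nonneg (Real.exp_pos _).le, mul_assoc,
      mul_comm (‖v - v'‖)]
    gcongr
    exact (v - v').norm_coe_le_norm s
  have hΦdiff : ∀ v v' t, ‖Φ v t - Φ v' t‖ ≤ ℓ * ‖v - v'‖ / c := fun v v' t => by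
    have : Φ v t - Φ v' t =
        Real.exp (-(c * max t 0)) • ∫ s in (0 : ℝ)..(max t 0), (ψ v s - ψ v' s) := by
      rw [intervalIntegral.integral_sub (hψi v _ _) (hψi v' _ _)]
      simp only [Φ, I]; module
    rw [this]
    exact norm_integral_exp_weight_le hc0 (le_max_right _ _) (by positivity) (hdiff v v')
  have hΦ0 : ∀ t, ‖Φ 0 t‖ ≤ ‖x₀‖ := fun t => by
    simp only [Φ, I, ψ, BoundedContinuousFunction.coe_zero, Pi.zero_apply, smul_zero, hf0,
      intervalIntegral.integral_zero, add_zero]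
    rw [norm_smul, Real.norm_of_nonneg (Real.exp_pos _).le]
    refine mul_le_of_le_one_left (norm_nonneg _) (Real.exp_le_one_iff.2 ?_)
    have : 0 ≤ max t 0 := le_max_right _ _
    have := mul_nonneg hc0.le this
    linarith
  let Ψ : (ℝ →ᵇ E) → (ℝ →ᵇ E) := fun v =>
    BoundedContinuousFunction.ofNormedAddCommGroup (Φ v)
      (by have := hIc v; simp only [Φ]; fun_prop) (‖x₀‖ + ℓ * ‖v - 0‖ / c) fun t => by
        have := norm_add_le_of_le (hΦ0 t) (hΦdiff v 0 t)
        rwa [add_sub_cancel] at this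
  have hcontr : ContractingWith (1 / 2) Ψ := by
    refine ⟨by rw [← NNReal.coe_lt_coe]; norm_num, LipschitzWith.of_dist_le_mul fun v v' => ?_⟩
    rw [BoundedContinuousFunction.dist_le (by positivity)]
    intro t
    rw [dist_eq_norm, dist_eq_norm]
    refine (hΦdiff v v' t).trans ?_
    rw [div_le_iff₀ hc0, hc]
    push_cast
    nlinarith [norm_nonneg (v - v')]
  obtain ⟨v, hv⟩ : ∃ v, Ψ v = v := ⟨_, hcontr.fixedPoint_isFixedPt⟩
  have hvt : ∀ t, 0 ≤ t → Real.exp (c * t) • v t = x₀ + ∫ s in (0 : ℝ)..t, ψ v s := by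
    intro t ht
    have h : v t = Φ v t := by conv_lhs => rw [← hv]
                               rfl
    rw [h]
    simp only [Φ, I, max_eq_left ht]
    rw [smul_smul, ← Real.exp_add]; simp
  refine ⟨fun t => Real.exp (c * t) • v t, by simpa using hvt 0 le_rfl, fun t ht => ?_⟩
  have hder : HasDerivAt (fun t => x₀ + ∫ s in (0 : ℝ)..t, ψ v s) (ψ v t) t :=
    ((hψc v).integral_hasStrictDerivAt 0 t).hasDerivAt.const_add x₀
  exact hder.hasDerivWithinAt.congr (fun s hs => hvt s hs) (hvt t ht)

theorem IsODESolution.continuousOn {f : E → E} {u : ℝ → E} (hu : IsODESolution f u) :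
    ContinuousOn u (Set.Ici 0) := fun t ht => (hu t ht).continuousWithinAt

/-- The error of an Euler step along a solution. -/
theorem IsODESolution.exists_euler_error_le {f : E → E} (hf : Continuous f) {u : ℝ → E}
    (hu : IsODESolution f u) (T : ℝ) {ε : ℝ} (hε : 0 < ε) :
    ∃ δ > 0, ∀ s r : ℝ, 0 ≤ s → 0 ≤ r → r ≤ δ → s + r ≤ T →
      ‖u (s + r) - u s - r • f (u s)‖ ≤ ε * r := by
  have hc : ContinuousOn (fun t => f (u t)) (Set.Icc 0 T) :=
    hf.comp_continuousOn (hu.continuousOn.mono Set.Icc_subset_Ici_self)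
  have huc := isCompact_Icc.uniformContinuousOn_of_continuous hc
  rw [Metric.uniformContinuousOn_iff_le] at huc
  obtain ⟨δ, hδ, huδ⟩ := huc ε hε
  refine ⟨δ, hδ, fun s r hs hr hrδ hT => ?_⟩
  -- Subtracting the linear motion leaves the derivative `f (u t) - f (u s)`, small by uniform
  -- continuity.
  have hder : ∀ t ∈ Set.Icc s (s + r),
      HasDerivWithinAt (fun t => u t - t • f (u s)) (f (u t) - f (u s)) (Set.Icc s (s + r)) t := by
    intro t ht
    have h1 := (hu t (hs.trans ht.1)).mono (fun z hz => hs.trans hz.1 : Set.Icc s (s + r) ⊆ Set.Ici 0)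
    have h2 := (hasDerivWithinAt_id t (Set.Icc s (s + r))).smul_const (f (u s))
    rw [one_smul] at h2
    exact h1.sub h2
  have hb : ∀ t ∈ Set.Ico s (s + r), ‖f (u t) - f (u s)‖ ≤ ε := by
    intro t ht
    rw [← dist_eq_norm]
    refine huδ t ⟨hs.trans ht.1, by linarith [ht.2]⟩ s ⟨hs, by linarith⟩ ?_
    rw [Real.dist_eq, abs_of_nonneg (by linarith [ht.1])]
    linarith [ht.2]
  have := norm_image_sub_le_of_norm_deriv_le_segment' hder hb (s + r) ⟨by linarith, le_rfl⟩
  calc _ = ‖u (s + r) - (s + r) • f (u s) - (u s - s • f (u s))‖ := by congr 1; module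
    _ ≤ ε * (s + r - s) := this
    _ = ε * r := by ring

end ODE

/-! ### The rescaled iteration follows the limiting ODE -/

/-- A two-timescale iteration along one noise path. At step `i` the increments are `H i` and `G i`,
`F i` is the limit of the rescaled fast increment at `y = 0`, with mean field `f`, and `Λ i` and
`Λb i` are the Lipschitz constants. -/
structure IterationPath {V U : Type*} [NormedAddCommGroup V] [NormedSpace ℝ V]
    [NormedAddCommGroup U] [NormedSpace ℝ U] (α β : ℕ → ℝ) (H : ℕ → V → U → V)
    (G : ℕ → V → U → U) (F : ℕ → V → V) (f : V → V) (Λ Λb : ℕ → ℝ) (κ : ℝ → ℝ)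
    (x : ℕ → V) (y : ℕ → U) : Prop where
  rates : LearningRates α β
  fast_step : ∀ i, x (i + 1) = x i + α i • H (i + 1) (x i) (y i)
  slow_step : ∀ i, y (i + 1) = y i + β i • G (i + 1) (x i) (y i)
  fast_lipschitz : ∀ i x x' y y', ‖H i x y - H i x' y'‖ ≤ Λ i * (‖x - x'‖ + ‖y - y'‖)
  slow_lipschitz : ∀ i x x' y y', ‖G i x y - G i x' y'‖ ≤ Λ i * (‖x - x'‖ + ‖y - y'‖)
  limit_lipschitz : ∀ i x x', ‖F i x - F i x'‖ ≤ Λ i * ‖x - x'‖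
  const_nonneg : ∀ i, 0 ≤ Λ i
  scaling : ∀ r, 1 ≤ r → ∀ i x,
    ‖r⁻¹ • H i (r • x) 0 - F i x - r⁻¹ • H i 0 0‖ ≤ |κ r| * Λb i * ‖x‖
  scaling_const_nonneg : ∀ i, 0 ≤ Λb i
  scaling_tendsto : Tendsto κ atTop (𝓝 0)
  limit_averages : ∀ x, Tendsto (fun n => α n • ∑ i ∈ Finset.Icc 1 n, (F i x - f x)) atTop (𝓝 0)
  fast_averages : ∃ m, Tendsto (fun n => α n • ∑ i ∈ Finset.Icc 1 n, (H i 0 0 - m)) atTop (𝓝 0)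
  slow_averages : ∃ m, Tendsto (fun n => β n • ∑ i ∈ Finset.Icc 1 n, (G i 0 0 - m)) atTop (𝓝 0)
  const_averages : ∃ m, Tendsto (fun n => α n • ∑ i ∈ Finset.Icc 1 n, (Λ i - m)) atTop (𝓝 0)
  scaling_const_averages :
    ∃ m, Tendsto (fun n => α n • ∑ i ∈ Finset.Icc 1 n, (Λb i - m)) atTop (𝓝 0)
  field_lipschitz : ∃ ℓ, 0 ≤ ℓ ∧ ∀ x x', ‖f x - f x'‖ ≤ ℓ * ‖x - x'‖
  field_zero : f 0 = 0
  attractive : ∀ u : ℝ → V, IsODESolution f u → Tendsto u atTop (𝓝 0)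

namespace IterationPath

variable {V U : Type*} [NormedAddCommGroup V] [NormedSpace ℝ V]
    [NormedAddCommGroup U] [NormedSpace ℝ U] {α β : ℕ → ℝ} {H : ℕ → V → U → V}
    {G : ℕ → V → U → U} {F : ℕ → V → V} {f : V → V} {Λ Λb : ℕ → ℝ} {κ : ℝ → ℝ}
    {x : ℕ → V} {y : ℕ → U}

theorem alpha_nonneg (P : IterationPath α β H G F f Λ Λb κ x y) (i : ℕ) : 0 ≤ α i :=
  (P.rates.fast.pos i).le

theorem eventually_slow_le (P : IterationPath α β H G F f Λ Λb κ x y) {η : ℝ} (hη : 0 < η) :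
    ∀ᶠ i in atTop, β i ≤ η * α i := by
  filter_upwards [P.rates.separation.eventually (ge_mem_nhds hη)] with i hi
  exact (div_le_iff₀ (P.rates.fast.pos i)).1 hi

/-- The rescaled iteration follows a given trajectory of the limiting field over a window. -/
theorem eventually_rescaled_close (P : IterationPath α β H G F f Λ Λb κ x y) {u : ℝ → V}
    (hu : IsODESolution f u) {T : ℝ} (hT : 0 < T) {τ : ℝ} (hτ : 0 < τ) :
    ∃ ρ > 0, ∃ K : ℝ, 1 ≤ K ∧ ∀ᶠ n in atTop, K * (1 + ‖y n‖) ≤ ‖x n‖ →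
      ‖‖x n‖⁻¹ • x n - u 0‖ ≤ ρ → ∀ k, n ≤ k → elapsed α n k ≤ T →
        ‖‖x n‖⁻¹ • x k - u (elapsed α n k)‖ ≤ τ := by
  have hα := P.rates.fast
  have hα0 := P.alpha_nonneg
  obtain ⟨mΛ, hmΛ⟩ := P.const_averages
  obtain ⟨mb, hmb⟩ := P.scaling_const_averages
  obtain ⟨mH, hmH⟩ := P.fast_averages
  obtain ⟨mG, hmG⟩ := P.slow_averages
  obtain ⟨ℓ, hℓ0, hℓ⟩ := P.field_lipschitz
  have hfc : Continuous f := by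
    refine (LipschitzWith.of_dist_le_mul (K := ⟨ℓ, hℓ0⟩) fun x y => ?_).continuous
    rw [dist_eq_norm, dist_eq_norm]; exact hℓ x y
  have huc : ContinuousOn u (Set.Icc 0 T) := hu.continuousOn.mono Set.Icc_subset_Ici_self
  obtain ⟨R, hR0, hR⟩ : ∃ R > 0, ∀ t ∈ Set.Icc 0 T, ‖u t‖ ≤ R := by
    obtain ⟨R, hR⟩ := (isCompact_Icc.image_of_continuousOn huc).isBounded.exists_norm_le
    exact ⟨|R| + 1, by positivity, fun t ht =>
      (hR _ (Set.mem_image_of_mem u ht)).trans ((le_abs_self R).trans (by linarith))⟩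
  set Q := T * ‖mΛ‖ + 1 with hQ
  set Qb := T * ‖mb‖ + 1 with hQb
  set QH := T * ‖mH‖ + 1 with hQH
  set QG := T * ‖mG‖ + 1 with hQG
  have hQ0 : 0 < Q := by positivity
  have hQb0 : 0 < Qb := by positivity
  have hQH0 : 0 < QH := by positivity
  have hQG0 : 0 < QG := by positivity
  -- Eight errors of size `ε` (five fast, three slow) are amplified by the Grönwall factor `exp (2 *
  -- Q)`.
  set ε := τ / (8 * Real.exp (2 * Q)) with hε
  have hε0 : 0 < ε := by positivity
  -- The bound `1` keeps the slow elapsed time below the fast one; `ε / (R * Q)` makes the drift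
  -- that `u` induces in the slow iterate at most `ε`.
  set η := min 1 (ε / (R * Q)) with hη
  have hη0 : 0 < η := by positivity
  obtain ⟨r₀, hr₀⟩ : ∃ r₀ : ℝ, ∀ r, r₀ ≤ r → |κ r| ≤ ε / (R * Qb) := by
    have h := P.scaling_tendsto.abs
    rw [abs_zero] at h
    exact eventually_atTop.1 (h.eventually (ge_mem_nhds (by positivity)))
  obtain ⟨δ, hδ0, hδ⟩ := hu.exists_euler_error_le hfc T (ε := ε / T) (by positivity)
  have hΛw : ∀ᶠ n in atTop, ∀ k, n ≤ k → elapsed α n k ≤ T →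
      ∑ i ∈ Finset.Ico n k, α i * Λ (i + 1) ≤ Q := by
    filter_upwards [eventually_norm_window_sum_le_of_mean hα hmΛ T] with n hn k hk hkT
    exact (le_abs_self _).trans (hn k hk hkT)
  have hbw : ∀ᶠ n in atTop, ∀ k, n ≤ k → elapsed α n k ≤ T →
      ∑ i ∈ Finset.Ico n k, α i * Λb (i + 1) ≤ Qb := by
    filter_upwards [eventually_norm_window_sum_le_of_mean hα hmb T] with n hn k hk hkT
    exact (le_abs_self _).trans (hn k hk hkT)
  have hcurve : ∀ᶠ n in atTop, ∀ k, n ≤ k → elapsed α n k ≤ T →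
      ‖∑ i ∈ Finset.Ico n k, α i • (F (i + 1) (u (elapsed α n i)) - f (u (elapsed α n i)))‖
        ≤ ε := by
    refine eventually_norm_window_sum_curve_le hα (ξ := fun x i => F i x - f x) P.limit_averages
      (Λ := fun i => Λ i + ℓ) (fun x x' i => ?_) (fun i => add_nonneg (P.const_nonneg i) hℓ0) hT
      (Q := Q + ℓ * T) ?_ huc hε0
    · calc _ = ‖(F i x - F i x') - (f x - f x')‖ := by congr 1; abel
        _ ≤ Λ i * ‖x - x'‖ + ℓ * ‖x - x'‖ :=
          (norm_sub_le _ _).trans (add_le_add (P.limit_lipschitz i x x') (hℓ x x'))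
        _ = _ := by ring
    · filter_upwards [hΛw] with n hn k hk hkT
      simp only [mul_add, Finset.sum_add_distrib]
      refine add_le_add (hn k hk hkT) ?_
      rw [← Finset.sum_mul, mul_comm]
      exact mul_le_mul_of_nonneg_left hkT hℓ0
  -- Dominance with this `K` forces `‖x n‖ ≥ r₀`, so that `κ` is small, and makes `QH`, `QG` and `‖y
  -- n‖` at most `ε` after division by `‖x n‖`.
  refine ⟨ε, hε0, 1 + |r₀| + (1 + QH + QG) / ε, by
    have : 0 ≤ (1 + QH + QG) / ε := by positivity
    linarith [abs_nonneg r₀], ?_⟩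
  filter_upwards [hΛw, hbw, hcurve, eventually_norm_window_sum_le_of_mean hα hmH T,
    eventually_norm_window_sum_le_of_mean P.rates.slow hmG T,
    eventually_forall_ge_atTop.2 (P.eventually_slow_le hη0),
    eventually_forall_ge_atTop.2 (hα.tendsto_zero.eventually (ge_mem_nhds hδ0))]
    with n hΛn hbn hcn hHn hGn hβn hδn hxn hun m hnm hmT
  set r := ‖x n‖ with hr
  have hq : 0 ≤ (1 + QH + QG) / ε := by positivity
  have hKr : 1 + |r₀| + (1 + QH + QG) / ε ≤ r := by
    refine le_trans (le_mul_of_one_le_right ?_ ?_) hxn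
    · positivity
    · linarith [norm_nonneg (y n)]
  have hr1 : 1 ≤ r := by linarith [abs_nonneg r₀]
  have hr0 : 0 < r := by linarith
  have hκ : |κ r| ≤ ε / (R * Qb) := hr₀ r (by linarith [le_abs_self r₀])
  have hrQ : 1 + QH + QG ≤ r * ε := by
    rw [← div_le_iff₀ hε0]; linarith [abs_nonneg r₀]
  have hHr : r⁻¹ * QH ≤ ε := by
    rw [inv_mul_le_iff₀ hr0]; linarith
  have hGr : r⁻¹ * QG ≤ ε := by
    rw [inv_mul_le_iff₀ hr0]; linarith
  have hyr : r⁻¹ * ‖y n‖ ≤ ε := by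
    rw [inv_mul_le_iff₀ hr0]
    have h1 : (1 + QH + QG) / ε * ‖y n‖ ≤ r := by
      refine le_trans ?_ hxn
      gcongr
      · linarith [abs_nonneg r₀]
      · linarith
    rw [div_mul_eq_mul_div, div_le_iff₀ hε0] at h1
    nlinarith [norm_nonneg (y n)]
  set t : ℕ → ℝ := elapsed α n with ht
  have ht0 : ∀ i, 0 ≤ t i := elapsed_nonneg hα0 n
  have htT : ∀ i, i ≤ m → t i ≤ T := fun i hi => (elapsed_mono hα0 n hi).trans hmT
  set e : ℕ → V := fun k => r⁻¹ • x k - u (t k) with he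
  set z : ℕ → U := fun k => r⁻¹ • y k with hz
  have huR : ∀ i, i ≤ m → ‖u (t i)‖ ≤ R := fun i hi => hR _ ⟨ht0 i, htT i hi⟩
  have hfast : ∀ k, n ≤ k → k ≤ m →
      ‖e k‖ ≤ 5 * ε + ∑ i ∈ Finset.Ico n k, α i * Λ (i + 1) * (‖e i‖ + ‖z i‖) := by
    intro k hk hkm
    have hkT := htT k hkm
    -- Error splitting: `D` is the Lipschitz feedback kept for Grönwall, `B` the scaling error, `C`
    -- the noise along `u`, `S` the Euler error. The increment at the origin is treated apart, being
    -- small only after division by `r`.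
    set D : ℕ → V := fun i =>
      (α i * r⁻¹) • (H (i + 1) (x i) (y i) - H (i + 1) (r • u (t i)) 0)
    set B : ℕ → V := fun i => α i • (r⁻¹ • H (i + 1) (r • u (t i)) 0 - F (i + 1) (u (t i)) -
      r⁻¹ • H (i + 1) 0 0)
    set C : ℕ → V := fun i => α i • (F (i + 1) (u (t i)) - f (u (t i)))
    set S : ℕ → V := fun i => u (t (i + 1)) - u (t i) - α i • f (u (t i))
    have hstep : ∀ i ∈ Finset.Ico n k,
        e (i + 1) - e i = D i + B i + C i + r⁻¹ • (α i • H (i + 1) 0 0) - S i := by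
      intro i hi
      simp only [he, D, B, C, S, P.fast_step i]
      module
    have hD : ‖∑ i ∈ Finset.Ico n k, D i‖ ≤
        ∑ i ∈ Finset.Ico n k, α i * Λ (i + 1) * (‖e i‖ + ‖z i‖) := by
      refine norm_sum_le_of_le _ fun i hi => ?_
      have e1 : x i - r • u (t i) = r • e i := by
        simp only [he, smul_sub, smul_smul, mul_inv_cancel₀ hr0.ne', one_smul]
      have e2 : y i - (0 : U) = r • z i := by
        simp only [hz, smul_smul, mul_inv_cancel₀ hr0.ne', one_smul, sub_zero]
      have h := P.fast_lipschitz (i + 1) (x i) (r • u (t i)) (y i) 0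
      rw [e1, e2, norm_smul, norm_smul, Real.norm_of_nonneg hr0.le] at h
      simp only [D]
      rw [norm_smul, Real.norm_of_nonneg (mul_nonneg (hα0 i) (inv_nonneg.2 hr0.le))]
      calc _ ≤ α i * r⁻¹ * (Λ (i + 1) * (r * ‖e i‖ + r * ‖z i‖)) :=
            mul_le_mul_of_nonneg_left h (mul_nonneg (hα0 i) (inv_nonneg.2 hr0.le))
        _ = _ := by field_simp
    have hB : ‖∑ i ∈ Finset.Ico n k, B i‖ ≤ ε := by
      calc _ ≤ ∑ i ∈ Finset.Ico n k, α i * Λb (i + 1) * (ε / (R * Qb) * R) := by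
            refine norm_sum_le_of_le _ fun i hi => ?_
            simp only [B]
            rw [norm_smul, Real.norm_of_nonneg (hα0 i), mul_assoc]
            refine mul_le_mul_of_nonneg_left ((P.scaling r hr1 _ _).trans ?_) (hα0 i)
            have := P.scaling_const_nonneg (i + 1)
            calc _ ≤ ε / (R * Qb) * Λb (i + 1) * R := by
                  gcongr
                  exact huR i ((Finset.mem_Ico.1 hi).2.le.trans hkm)
              _ = _ := by ring
        _ = (∑ i ∈ Finset.Ico n k, α i * Λb (i + 1)) * (ε / (R * Qb) * R) := by
            rw [Finset.sum_mul]
        _ ≤ Qb * (ε / (R * Qb) * R) := by gcongr; exact hbn k hk hkT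
        _ = ε := by field_simp
    have hS : ‖∑ i ∈ Finset.Ico n k, S i‖ ≤ ε := by
      calc _ ≤ ∑ i ∈ Finset.Ico n k, ε / T * α i := by
            refine norm_sum_le_of_le _ fun i hi => ?_
            obtain ⟨h1, h2⟩ := Finset.mem_Ico.1 hi
            have h3 : t (i + 1) = t i + α i := elapsed_succ α h1
            have h4 := htT (i + 1) (by omega)
            simp only [S]
            rw [h3] at h4 ⊢
            exact hδ (t i) (α i) (ht0 i) (hα0 i) (hδn i h1) h4
        _ = ε / T * t k := by rw [← Finset.mul_sum]; rfl
        _ ≤ ε / T * T := by gcongr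
        _ = ε := div_mul_cancel₀ _ hT.ne'
    have hH0 : ‖∑ i ∈ Finset.Ico n k, r⁻¹ • (α i • H (i + 1) 0 0)‖ ≤ ε := by
      rw [← Finset.smul_sum, norm_smul, Real.norm_of_nonneg (inv_nonneg.2 hr0.le)]
      refine le_trans ?_ hHr
      gcongr
      exact hHn k hk hkT
    have hen : ‖e n‖ ≤ ε := by
      simpa only [he, ht, elapsed_self] using hun
    rw [eq_add_window_sum_sub e hk, Finset.sum_congr rfl hstep, Finset.sum_sub_distrib,
      Finset.sum_add_distrib, Finset.sum_add_distrib, Finset.sum_add_distrib]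
    have hC := hcn k hk hkT
    refine (norm_add_le_of_le hen (norm_sub_le_of_le (norm_add_le_of_le (norm_add_le_of_le
      (norm_add_le_of_le hD hB) hC) hH0) hS)).trans (le_of_eq (by ring))
  have hslow : ∀ k, n ≤ k → k ≤ m →
      ‖z k‖ ≤ 3 * ε + ∑ i ∈ Finset.Ico n k, α i * Λ (i + 1) * (‖e i‖ + ‖z i‖) := by
    intro k hk hkm
    have hkT := htT k hkm
    have hβ0 : ∀ i, 0 ≤ β i := fun i => (P.rates.slow.pos i).le
    have hβT : elapsed β n k ≤ T := by
      refine le_trans (Finset.sum_le_sum fun i hi => ?_) hkT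
      refine (hβn i (Finset.mem_Ico.1 hi).1).trans ?_
      exact mul_le_of_le_one_left (hα0 i) (min_le_left _ _)
    set D : ℕ → U := fun i => (β i * r⁻¹) • (G (i + 1) (x i) (y i) - G (i + 1) 0 0)
    have hstep : ∀ i ∈ Finset.Ico n k,
        z (i + 1) - z i = D i + r⁻¹ • (β i • G (i + 1) 0 0) := by
      intro i hi
      simp only [hz, D, P.slow_step i]
      module
    have hD : ‖∑ i ∈ Finset.Ico n k, D i‖ ≤
        ε + ∑ i ∈ Finset.Ico n k, α i * Λ (i + 1) * (‖e i‖ + ‖z i‖) := by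
      calc _ ≤ ∑ i ∈ Finset.Ico n k, (α i * Λ (i + 1) * (η * R) +
              α i * Λ (i + 1) * (‖e i‖ + ‖z i‖)) := by
            refine norm_sum_le_of_le _ fun i hi => ?_
            obtain ⟨h1, h2⟩ := Finset.mem_Ico.1 hi
            have hL := P.const_nonneg (i + 1)
            have e1 : x i - (0 : V) = r • (e i + u (t i)) := by
              simp only [he, sub_add_cancel, smul_smul, mul_inv_cancel₀ hr0.ne', one_smul,
                sub_zero]
            have e2 : y i - (0 : U) = r • z i := by
              simp only [hz, smul_smul, mul_inv_cancel₀ hr0.ne', one_smul, sub_zero]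
            have h := P.slow_lipschitz (i + 1) (x i) 0 (y i) 0
            rw [e1, e2, norm_smul, norm_smul, Real.norm_of_nonneg hr0.le] at h
            simp only [D]
            rw [norm_smul, Real.norm_of_nonneg (mul_nonneg (hβ0 i) (inv_nonneg.2 hr0.le))]
            have hsum : ‖e i + u (t i)‖ ≤ ‖e i‖ + R :=
              norm_add_le_of_le le_rfl (huR i (by omega))
            have hα0i := hα0 i
            calc _ ≤ β i * r⁻¹ * (Λ (i + 1) * (r * ‖e i + u (t i)‖ + r * ‖z i‖)) :=
                  mul_le_mul_of_nonneg_left h (mul_nonneg (hβ0 i) (inv_nonneg.2 hr0.le))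
              _ = β i * (Λ (i + 1) * (‖e i + u (t i)‖ + ‖z i‖)) := by field_simp
              _ ≤ η * α i * (Λ (i + 1) * (‖e i‖ + R + ‖z i‖)) := by
                  gcongr
                  exact hβn i h1
              _ = α i * Λ (i + 1) * (η * R) + η * (α i * Λ (i + 1) * (‖e i‖ + ‖z i‖)) := by ring
              _ ≤ _ := add_le_add le_rfl
                  (mul_le_of_le_one_left (by positivity) (min_le_left _ _))
        _ = (∑ i ∈ Finset.Ico n k, α i * Λ (i + 1)) * (η * R) +
              ∑ i ∈ Finset.Ico n k, α i * Λ (i + 1) * (‖e i‖ + ‖z i‖) := by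
            rw [Finset.sum_add_distrib, Finset.sum_mul]
        _ ≤ _ := by
            gcongr
            calc _ ≤ Q * (ε / (R * Q) * R) := by
                  gcongr
                  · exact hΛn k hk hkT
                  · exact min_le_right _ _
              _ = ε := by field_simp
    have hG0 : ‖∑ i ∈ Finset.Ico n k, r⁻¹ • (β i • G (i + 1) 0 0)‖ ≤ ε := by
      rw [← Finset.smul_sum, norm_smul, Real.norm_of_nonneg (inv_nonneg.2 hr0.le)]
      refine le_trans ?_ hGr
      gcongr
      exact hGn k hk hβT
    have hzn : ‖z n‖ ≤ ε := by
      simp only [hz]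
      rwa [norm_smul, Real.norm_of_nonneg (inv_nonneg.2 hr0.le)]
    rw [eq_add_window_sum_sub z hk, Finset.sum_congr rfl hstep, Finset.sum_add_distrib]
    exact (norm_add_le_of_le hzn (norm_add_le_of_le hD hG0)).trans (le_of_eq (by ring))
  -- The two errors feed each other with the same weights, so Grönwall is applied to their sum.
  have hgron := le_mul_exp_of_le_add_window_sum (v := fun i => ‖e i‖ + ‖z i‖)
    (c := fun i => 2 * (α i * Λ (i + 1))) (A := 8 * ε) (by positivity)
    (fun i => mul_nonneg zero_le_two (mul_nonneg (hα0 i) (P.const_nonneg _))) (n := n) (m := m)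
    (fun k hk hkm => by
      have h1 := hfast k hk hkm
      have h2 := hslow k hk hkm
      simp only [mul_assoc (2 : ℝ), ← Finset.mul_sum]
      linarith) hnm le_rfl
  have hexp : ∑ i ∈ Finset.Ico n m, 2 * (α i * Λ (i + 1)) ≤ 2 * Q := by
    rw [← Finset.mul_sum]
    linarith [hΛn m hnm hmT]
  calc ‖e m‖ ≤ ‖e m‖ + ‖z m‖ := le_add_of_nonneg_right (norm_nonneg _)
    _ ≤ 8 * ε * Real.exp (2 * Q) := hgron.trans (by gcongr)
    _ = τ := by rw [hε]; field_simp

end IterationPath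

/-! ### Descent of a dominant fast iterate -/

namespace IterationPath

variable {V U : Type*} [NormedAddCommGroup V] [NormedSpace ℝ V]
    [NormedAddCommGroup U] [NormedSpace ℝ U] {α β : ℕ → ℝ} {H : ℕ → V → U → V}
    {G : ℕ → V → U → U} {F : ℕ → V → V} {f : V → V} {Λ Λb : ℕ → ℝ} {κ : ℝ → ℝ}
    {x : ℕ → V} {y : ℕ → U}

/-- From a dominant fast iterate with direction near `x₀`, the fast iterate returns below its initial size
and stays of the same order until then. -/
theorem exists_local_descent [CompleteSpace V] (P : IterationPath α β H G F f Λ Λb κ x y)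
    (x₀ : V) :
    ∃ ρ > 0, ∃ K R : ℝ, 1 ≤ K ∧ ∀ᶠ n in atTop, K * (1 + ‖y n‖) ≤ ‖x n‖ →
      ‖‖x n‖⁻¹ • x n - x₀‖ ≤ ρ → ∃ k, n < k ∧ ‖x k‖ ≤ ‖x n‖ ∧
        ∀ i, n ≤ i → i ≤ k → ‖x i‖ ≤ R * ‖x n‖ := by
  have hα := P.rates.fast
  obtain ⟨ℓ, hℓ0, hℓ⟩ := P.field_lipschitz
  obtain ⟨u, hu0, hu⟩ := exists_isODESolution hℓ0 hℓ P.field_zero x₀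
  have hlim := (P.attractive u hu).norm
  rw [norm_zero] at hlim
  obtain ⟨T₁, hT₁⟩ := eventually_atTop.1
    (hlim.eventually (ge_mem_nhds (by norm_num : (0 : ℝ) < 1 / 2)))
  set T := max T₁ 1 with hT
  have hT0 : 0 < T := lt_of_lt_of_le one_pos (le_max_right _ _)
  have huc : ContinuousOn u (Set.Icc 0 (T + 1)) := hu.continuousOn.mono Set.Icc_subset_Ici_self
  obtain ⟨R, hR⟩ := (isCompact_Icc.image_of_continuousOn huc).isBounded.exists_norm_le
  -- The window has length `T + 1` because stopping may overshoot `T` by one step. Tracking error `1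
  -- / 2` plus `‖u‖ ≤ 1 / 2` gives the factor `1`.
  obtain ⟨ρ, hρ, K, hK, hclose⟩ := P.eventually_rescaled_close hu (T := T + 1) (by linarith)
    (τ := 1 / 2) (by norm_num)
  refine ⟨ρ, hρ, K, R + 1 / 2, hK, ?_⟩
  filter_upwards [hclose, eventually_forall_ge_atTop.2
    (hα.tendsto_zero.eventually (ge_mem_nhds one_pos))] with n hn hαn hxn hdir
  obtain ⟨k, hnk, hTk, hkT⟩ := exists_elapsed_mem_Icc hα hαn hT0
  have hx0 : 0 < ‖x n‖ := by
    have : 0 < K * (1 + ‖y n‖) := by positivity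
    linarith
  have key : ∀ i b, n ≤ i → i ≤ k → ‖u (elapsed α n i)‖ ≤ b →
      ‖x i‖ ≤ (b + 1 / 2) * ‖x n‖ := by
    intro i b hi hik hb
    have h := hn hxn (by rwa [hu0]) i hi
      ((elapsed_mono P.alpha_nonneg n hik).trans hkT)
    have h2 := norm_add_le_of_le hb h
    rw [add_sub_cancel, norm_smul, norm_inv, norm_norm, inv_mul_le_iff₀ hx0] at h2
    linarith
  refine ⟨k, hnk, ?_, fun i hi hik => key i R hi hik (hR _ (Set.mem_image_of_mem u
    ⟨elapsed_nonneg P.alpha_nonneg n i, (elapsed_mono P.alpha_nonneg n hik).trans hkT⟩))⟩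
  have := key k (1 / 2) hnk.le le_rfl (hT₁ _ ((le_max_left _ _).trans hTk))
  linarith

/-- Descent of the fast iterate whenever it dominates the slow one. -/
theorem exists_descent [ProperSpace V] (P : IterationPath α β H G F f Λ Λb κ x y) :
    ∃ K R : ℝ, 1 ≤ K ∧ ∀ᶠ n in atTop, K * (1 + ‖y n‖) ≤ ‖x n‖ → ∃ k, n < k ∧ ‖x k‖ ≤ ‖x n‖ ∧
      ∀ i, n ≤ i → i ≤ k → ‖x i‖ ≤ R * ‖x n‖ := by
  suffices h : ∃ K R : ℝ, 1 ≤ K ∧ ∀ᶠ n in atTop, K * (1 + ‖y n‖) ≤ ‖x n‖ →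
      ‖x n‖⁻¹ • x n ∈ Metric.sphere (0 : V) 1 → ∃ k, n < k ∧ ‖x k‖ ≤ ‖x n‖ ∧
        ∀ i, n ≤ i → i ≤ k → ‖x i‖ ≤ R * ‖x n‖ by
    obtain ⟨K, R, hK, h⟩ := h
    refine ⟨K, R, hK, ?_⟩
    filter_upwards [h] with n hn hxn
    refine hn hxn ?_
    have hx0 : 0 < ‖x n‖ := by
      have : 0 < K * (1 + ‖y n‖) := by positivity
      linarith
    rw [mem_sphere_zero_iff_norm, norm_smul, norm_inv, norm_norm, inv_mul_cancel₀ hx0.ne']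
  -- The property passes to unions by taking maxima of the constants, so local descent near each
  -- direction suffices.
  refine (isCompact_sphere (0 : V) 1).induction_on (p := fun s => ∃ K R : ℝ, 1 ≤ K ∧
    ∀ᶠ n in atTop, K * (1 + ‖y n‖) ≤ ‖x n‖ → ‖x n‖⁻¹ • x n ∈ s → ∃ k, n < k ∧ ‖x k‖ ≤ ‖x n‖ ∧
      ∀ i, n ≤ i → i ≤ k → ‖x i‖ ≤ R * ‖x n‖) ?_ ?_ ?_ ?_
  · exact ⟨1, 1, le_rfl, Eventually.of_forall fun n _ h => absurd h (Set.notMem_empty _)⟩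
  · rintro s t hst ⟨K, R, hK, h⟩
    exact ⟨K, R, hK, h.mono fun n hn hxn hs => hn hxn (hst hs)⟩
  · rintro s t ⟨K, R, hK, h⟩ ⟨K', R', hK', h'⟩
    refine ⟨max K K', max R R', hK.trans (le_max_left _ _), ?_⟩
    filter_upwards [h, h'] with n hn hn' hxn hst
    rcases hst with hs | ht
    · obtain ⟨k, h1, h2, h3⟩ := hn (le_trans (by gcongr; exact le_max_left _ _) hxn) hs
      exact ⟨k, h1, h2, fun i hi hik => (h3 i hi hik).trans (by gcongr; exact le_max_left _ _)⟩
    · obtain ⟨k, h1, h2, h3⟩ := hn' (le_trans (by gcongr; exact le_max_right _ _) hxn) ht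
      exact ⟨k, h1, h2, fun i hi hik => (h3 i hi hik).trans (by gcongr; exact le_max_right _ _)⟩
  · intro x₀ _
    obtain ⟨ρ, hρ, K, R, hK, h⟩ := P.exists_local_descent x₀
    refine ⟨Metric.closedBall x₀ ρ, mem_nhdsWithin_of_mem_nhds (Metric.closedBall_mem_nhds x₀ hρ),
      K, R, hK, h.mono fun n hn hxn hs => hn hxn ?_⟩
    rwa [← mem_closedBall_iff_norm]

/-- `Λ (n + 1)` itself may be unbounded, but `α n * Λ (n + 1)` is a window sum over a single step
and hence eventually bounded. -/
theorem exists_one_step_le (P : IterationPath α β H G F f Λ Λb κ x y) (K : ℝ) :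
    ∃ C : ℝ, ∀ᶠ n in atTop, ‖x n‖ ≤ K * (1 + ‖y n‖) → ‖x (n + 1)‖ ≤ C * (1 + ‖y n‖) := by
  have hα := P.rates.fast
  obtain ⟨mΛ, hmΛ⟩ := P.const_averages
  obtain ⟨mH, hmH⟩ := P.fast_averages
  set Q := 1 * ‖mΛ‖ + 1 with hQ
  set QH := 1 * ‖mH‖ + 1 with hQH
  refine ⟨K + (Q * (K + 1) + QH), ?_⟩
  filter_upwards [eventually_norm_window_sum_le_of_mean hα hmΛ 1,
    eventually_norm_window_sum_le_of_mean hα hmH 1,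
    hα.tendsto_zero.eventually (ge_mem_nhds one_pos)] with n hΛn hHn hαn hxn
  have hone : elapsed α n (n + 1) ≤ 1 := by
    rwa [elapsed_succ α le_rfl, elapsed_self, zero_add]
  have h1 := hΛn (n + 1) (Nat.le_succ n) hone
  have h2 := hHn (n + 1) (Nat.le_succ n) hone
  rw [Nat.Ico_succ_singleton, Finset.sum_singleton] at h1 h2
  rw [smul_eq_mul] at h1
  have h1' : α n * Λ (n + 1) ≤ Q := (le_abs_self _).trans h1
  have hQ0 : 0 ≤ Q := by positivity
  have hQH0 : 0 ≤ QH := by positivity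
  have h3 := P.fast_lipschitz (n + 1) (x n) 0 (y n) 0
  rw [sub_zero, sub_zero] at h3
  have e : x (n + 1) = x n + (α n • (H (n + 1) (x n) (y n) - H (n + 1) 0 0) +
      α n • H (n + 1) 0 0) := by
    rw [P.fast_step]; module
  have h4 : ‖α n • (H (n + 1) (x n) (y n) - H (n + 1) 0 0)‖ ≤ Q * ((K + 1) * (1 + ‖y n‖)) := by
    rw [norm_smul, Real.norm_of_nonneg (P.alpha_nonneg n)]
    calc _ ≤ α n * (Λ (n + 1) * (‖x n‖ + ‖y n‖)) :=
          mul_le_mul_of_nonneg_left h3 (P.alpha_nonneg n)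
      _ = α n * Λ (n + 1) * (‖x n‖ + ‖y n‖) := by ring
      _ ≤ Q * ((K + 1) * (1 + ‖y n‖)) := by
          gcongr
          linarith
  rw [e]
  refine (norm_add_le_of_le hxn (norm_add_le_of_le h4 h2)).trans ?_
  have : QH ≤ QH * (1 + ‖y n‖) := le_mul_of_one_le_right hQH0 (by linarith [norm_nonneg (y n)])
  linarith

end IterationPath

/-! ### From recurrence to a bound at all times -/

/-- A bound that recurs, with control in between, holds up to a constant at all times. -/
theorem forall_le_mul_of_recurrent {s D : ℕ → ℝ} {B C : ℝ} {n₀ : ℕ} (h₀ : s n₀ ≤ C * D n₀)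
    (h : ∀ n, n₀ ≤ n → s n ≤ C * D n →
      ∃ k, n < k ∧ s k ≤ C * D k ∧ ∀ i, n ≤ i → i ≤ k → s i ≤ B * D i) :
    ∀ n, n₀ ≤ n → s n ≤ B * D n := by
  -- Each recurrence moves strictly forward, so the covered stretches exhaust all times.
  have key : ∀ j, ∃ k, n₀ + j < k ∧ s k ≤ C * D k ∧ ∀ i, n₀ ≤ i → i ≤ k → s i ≤ B * D i := by
    intro j
    induction j with
    | zero => exact h n₀ le_rfl h₀
    | succ j ih =>
      obtain ⟨k, hk, hkC, hkB⟩ := ih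
      obtain ⟨k', hk', hkC', hkB'⟩ := h k (by omega) hkC
      refine ⟨k', by omega, hkC', fun i hi hik => ?_⟩
      rcases le_total i k with hle | hle
      · exact hkB i hi hle
      · exact hkB' i hle hik
  intro n hn
  obtain ⟨k, hk, -, hkB⟩ := key (n - n₀)
  exact hkB n hn (by omega)

/-- The fast iterate is bounded by any monotone bound of the slow one. -/
theorem IterationPath.exists_norm_le {V U : Type*} [NormedAddCommGroup V] [NormedSpace ℝ V]
    [ProperSpace V] [NormedAddCommGroup U] [NormedSpace ℝ U] {α β : ℕ → ℝ} {H : ℕ → V → U → V}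
    {G : ℕ → V → U → U} {F : ℕ → V → V} {f : V → V} {Λ Λb : ℕ → ℝ} {κ : ℝ → ℝ} {x : ℕ → V}
    {y : ℕ → U} (P : IterationPath α β H G F f Λ Λb κ x y) {D : ℕ → ℝ} (hD : Monotone D)
    (hyD : ∀ n, 1 + ‖y n‖ ≤ D n) : ∃ K : ℝ, 0 ≤ K ∧ ∀ n, ‖x n‖ ≤ K * D n := by
  obtain ⟨K, R, hK, hdesc⟩ := P.exists_descent
  obtain ⟨C₁, hC₁⟩ := P.exists_one_step_le K
  obtain ⟨n₀, hn₀⟩ := eventually_atTop.1 (hdesc.and hC₁)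
  have hD1 : ∀ n, 1 ≤ D n := fun n => by linarith [hyD n, norm_nonneg (y n)]
  have hD0 : ∀ n, 0 ≤ D n := fun n => zero_le_one.trans (hD1 n)
  set C := max (max K C₁) ‖x n₀‖ with hC
  have hKC : K ≤ C := (le_max_left _ _).trans (le_max_left _ _)
  have hC₁C : C₁ ≤ C := (le_max_right _ _).trans (le_max_left _ _)
  have hC0 : 0 ≤ C := by linarith
  -- `C` is the constant at recurrence times, `B` the one during excursions; the `1` ensures `C ≤
  -- B`.
  set B := max 1 R * C with hB
  have hCB : C ≤ B := le_mul_of_one_le_left hC0 (le_max_left _ _)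
  have hlarge : ∀ n, n₀ ≤ n → ‖x n‖ ≤ B * D n := by
    refine forall_le_mul_of_recurrent (s := fun n => ‖x n‖) (C := C) ?_ fun n hn hxC => ?_
    · exact (le_max_right _ _).trans (le_mul_of_one_le_right hC0 (hD1 n₀))
    · have hy0 := norm_nonneg (y n)
      rcases le_total (K * (1 + ‖y n‖)) ‖x n‖ with hle | hle
      · obtain ⟨k, hnk, hk, hik⟩ := (hn₀ n hn).1 hle
        refine ⟨k, hnk, hk.trans (hxC.trans (by gcongr; exact hD hnk.le)), fun i hi hi' => ?_⟩
        calc ‖x i‖ ≤ R * ‖x n‖ := hik i hi hi'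
          _ ≤ max 1 R * (C * D n) := by
              gcongr
              exact le_max_right _ _
          _ ≤ max 1 R * (C * D i) := by gcongr; exact hD hi
          _ = B * D i := by rw [hB]; ring
      · have hstep : ‖x (n + 1)‖ ≤ C * D (n + 1) := by
          refine ((hn₀ n hn).2 hle).trans ?_
          calc C₁ * (1 + ‖y n‖) ≤ C * (1 + ‖y n‖) := by gcongr
            _ ≤ C * D (n + 1) := by gcongr; exact (hyD n).trans (hD (Nat.le_succ n))
        refine ⟨n + 1, Nat.lt_succ_self n, hstep, fun i hi hi' => ?_⟩
        have h : ‖x i‖ ≤ C * D i := by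
          rcases Nat.le_succ_iff.1 hi' with h | h
          · rwa [le_antisymm h hi]
          · rwa [h]
        exact h.trans (mul_le_mul_of_nonneg_right hCB (hD0 i))
  have hS : 0 ≤ ∑ i ∈ Finset.range n₀, ‖x i‖ := Finset.sum_nonneg fun i _ => norm_nonneg _
  refine ⟨B + ∑ i ∈ Finset.range n₀, ‖x i‖, by linarith, fun n => ?_⟩
  rcases le_total n₀ n with h | h
  · exact (hlarge n h).trans (mul_le_mul_of_nonneg_right (by linarith) (hD0 n))
  rcases h.eq_or_lt with h | h
  · exact (hlarge n h.ge).trans (mul_le_mul_of_nonneg_right (by linarith) (hD0 n))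
  · have h1 : ‖x n‖ ≤ ∑ i ∈ Finset.range n₀, ‖x i‖ :=
      Finset.single_le_sum (f := fun i => ‖x i‖) (fun i _ => norm_nonneg _) (Finset.mem_range.2 h)
    refine h1.trans ((?_ : _ ≤ B + ∑ i ∈ Finset.range n₀, ‖x i‖).trans
      (le_mul_of_one_le_right (by linarith) (hD1 n)))
    linarith

/-! ### From the hypotheses to an iteration path -/

theorem pairNorm_le {d₁ d₂ : ℕ} (x : Euc d₁) (y : Euc d₂) : pairNorm x y ≤ ‖x‖ + ‖y‖ := by
  rw [pairNorm, WithLp.prod_norm_eq_of_L2]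
  refine Real.sqrt_le_iff.2 ⟨by positivity, ?_⟩
  change ‖x‖ ^ 2 + ‖y‖ ^ 2 ≤ _
  nlinarith [mul_nonneg (norm_nonneg x) (norm_nonneg y)]

theorem pairNorm_zero_right {d₁ d₂ : ℕ} (x : Euc d₁) : pairNorm x (0 : Euc d₂) = ‖x‖ := by
  rw [pairNorm, WithLp.prod_norm_eq_of_L2]
  simp

/-- A pointwise Lipschitz constant is nonnegative as soon as the space is nontrivial. -/
theorem nonneg_of_lipschitz {d₁ d₂ k : ℕ} [NeZero d₁] {𝒲 : Type*}
    {F : Euc d₁ → Euc d₂ → 𝒲 → Euc k} {L : 𝒲 → ℝ}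
    (h : ∀ x x' y y' w, ‖F x y w - F x' y' w‖ ≤ L w * pairNorm (x - x') (y - y')) (w : 𝒲) :
    0 ≤ L w := by
  have h1 := (norm_nonneg _).trans (h (EuclideanSpace.single 0 1) 0 0 0 w)
  rw [sub_zero, sub_zero, pairNorm_zero_right] at h1
  simpa using h1

section ScalingLimit

variable {d₁ d₂ k : ℕ} {𝒲 : Type*} [MeasurableSpace 𝒲]
  {F Finf : Euc d₁ → Euc d₂ → 𝒲 → Euc k} {κ : ℝ → ℝ} {b : Euc d₁ → Euc d₂ → 𝒲 → Euc k}
  {Lb : 𝒲 → ℝ}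

/-- At the origin rescaling only divides by `c`, so both `F_c` and `κ(c) b` tend to `0`. -/
theorem ScalingLimit.limit_zero (h : ScalingLimit F Finf κ b Lb) (w : 𝒲) : Finf 0 0 w = 0 := by
  have h1 : Tendsto (fun c : ℝ => c⁻¹ • F 0 0 w - κ c • b 0 0 w) atTop (𝓝 0) := by
    have := (tendsto_inv_atTop_zero.smul_const (F 0 0 w)).sub (h.tendsto_zero.smul_const (b 0 0 w))
    simpa using this
  have h2 : (fun c : ℝ => c⁻¹ • F 0 0 w - κ c • b 0 0 w) =ᶠ[atTop] fun _ => Finf 0 0 w := by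
    filter_upwards [eventually_ge_atTop 1] with c hc
    have := h.eq c hc 0 0 w
    simp only [rescale, smul_zero] at this
    rw [← this, sub_sub_cancel]
  exact tendsto_nhds_unique (tendsto_const_nhds.congr' h2.symm) h1

/-- The limit increment at a point is a fixed linear combination of increments. -/
theorem ScalingLimit.exists_limit_eq (h : ScalingLimit F Finf κ b Lb) (x : Euc d₁) (y : Euc d₂) :
    ∃ c p q : ℝ, ∀ w, Finf x y w = p • F x y w + q • F (c • x) (c • y) w := by
  have h1 : ∀ w, F x y w - Finf x y w = κ 1 • b x y w := fun w => by
    simpa [rescale] using h.eq 1 le_rfl x y w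
  -- If `κ` takes a second value at `c`, the relations at `1` and `c` eliminate `b`. Otherwise `κ`
  -- is constant on `[1, ∞)`, hence `0`, and the limit is `F` itself.
  by_cases hκ : ∃ c, 1 ≤ c ∧ κ c ≠ κ 1
  · obtain ⟨c, hc, hne⟩ := hκ
    have hne' : κ c - κ 1 ≠ 0 := sub_ne_zero.2 hne
    refine ⟨c, 1 + κ 1 / (κ c - κ 1), -(κ 1 / (κ c - κ 1)) * c⁻¹, fun w => ?_⟩
    have h2 : c⁻¹ • F (c • x) (c • y) w - Finf x y w = κ c • b x y w := h.eq c hc x y w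
    have h3 : (κ c - κ 1) • b x y w = c⁻¹ • F (c • x) (c • y) w - F x y w := by
      rw [sub_smul, ← h1, ← h2]; abel
    have h4 : b x y w = (κ c - κ 1)⁻¹ • (c⁻¹ • F (c • x) (c • y) w - F x y w) := by
      rw [← h3, smul_smul, inv_mul_cancel₀ hne', one_smul]
    have h5 : Finf x y w = F x y w - κ 1 • b x y w := by rw [← h1, sub_sub_cancel]
    rw [h5, h4]
    module
  · push Not at hκ
    have hκ1 : κ 1 = 0 := by
      refine tendsto_nhds_unique (tendsto_const_nhds.congr' ?_) h.tendsto_zero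
      filter_upwards [eventually_ge_atTop 1] with c hc
      exact (hκ c hc).symm
    refine ⟨1, 1, 0, fun w => ?_⟩
    have := h1 w
    rw [hκ1, zero_smul, sub_eq_zero] at this
    simp [this]

theorem AveragesOut.add {V : Type*} [NormedAddCommGroup V] [NormedSpace ℝ V] {d : Measure 𝒲}
    {a : ℕ → ℝ} {w : ℕ → 𝒲} {γ γ' : 𝒲 → V} (h : AveragesOut d a w γ) (h' : AveragesOut d a w γ')
    (hi : Integrable γ d) (hi' : Integrable γ' d) :
    AveragesOut d a w (fun v => γ v + γ' v) := by
  have := Tendsto.add h h'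
  rw [add_zero] at this
  refine this.congr fun n => ?_
  rw [← smul_add, ← Finset.sum_add_distrib, integral_add hi hi']
  congr 1
  exact Finset.sum_congr rfl fun i _ => sub_add_sub_comm _ _ _ _

theorem AveragesOut.const_smul {V : Type*} [NormedAddCommGroup V] [NormedSpace ℝ V]
    {d : Measure 𝒲} {a : ℕ → ℝ} {w : ℕ → 𝒲} {γ : 𝒲 → V} (h : AveragesOut d a w γ) (c : ℝ) :
    AveragesOut d a w (fun v => c • γ v) := by
  have := Tendsto.const_smul h c
  rw [smul_zero] at this
  refine this.congr fun n => ?_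
  rw [integral_smul, smul_comm, Finset.smul_sum]
  simp only [smul_sub]

/-- Averaging is assumed for the increments but not for their limits; it transfers through the
linear combination. -/
theorem ScalingLimit.averagesOut_limit (h : ScalingLimit F Finf κ b Lb) {d : Measure 𝒲}
    (hF : ∀ x y, Integrable (F x y) d) {a : ℕ → ℝ} {w : ℕ → 𝒲}
    (hw : ∀ x y, AveragesOut d a w (F x y)) (x : Euc d₁) (y : Euc d₂) :
    AveragesOut d a w (Finf x y) := by
  obtain ⟨c, p, q, hc⟩ := h.exists_limit_eq x y
  rw [show Finf x y = fun v => p • F x y v + q • F (c • x) (c • y) v from funext hc]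
  exact ((hw x y).const_smul p).add ((hw _ _).const_smul q) ((hF x y).smul p) ((hF _ _).smul q)

/-- The rescaled increment at `y = 0` differs from its limit by the rescaled increment at the
origin and a term of size `κ(r) Lb(w) ‖x‖`. -/
theorem ScalingLimit.norm_rescale_sub_le (h : ScalingLimit F Finf κ b Lb) {r : ℝ} (hr : 1 ≤ r)
    (w : 𝒲) (x : Euc d₁) :
    ‖r⁻¹ • F (r • x) 0 w - Finf x 0 w - r⁻¹ • F 0 0 w‖ ≤ |κ r| * Lb w * ‖x‖ := by
  have h1 := h.eq r hr x 0 w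
  have h2 := h.eq r hr 0 0 w
  simp only [rescale, smul_zero, h.limit_zero, sub_zero] at h1 h2
  rw [h1, h2, ← smul_sub, norm_smul, Real.norm_eq_abs, mul_assoc]
  refine mul_le_mul_of_nonneg_left ?_ (abs_nonneg _)
  simpa [pairNorm_zero_right] using h.lipschitz x 0 0 0 w

end ScalingLimit

theorem norm_mean_sub_le {d₁ d₂ k : ℕ} {𝒲 : Type*} [MeasurableSpace 𝒲] {d : Measure 𝒲}
    {F Finf : Euc d₁ → Euc d₂ → 𝒲 → Euc k} {L : 𝒲 → ℝ} (h : LipschitzIncrement d F Finf L)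
    (hL : Integrable L d) (x x' : Euc d₁) :
    ‖mean d Finf x 0 - mean d Finf x' 0‖ ≤ (∫ w, L w ∂d) * ‖x - x'‖ := by
  rw [mean, mean, ← integral_sub (h.integrable_limit _ _) (h.integrable_limit _ _),
    ← integral_mul_const]
  refine norm_integral_le_of_norm_le (hL.mul_const _) (Eventually.of_forall fun w => ?_)
  simpa [pairNorm_zero_right] using h.lipschitz_limit x x' 0 0 w

/-- The iterates along one good noise path. -/
theorem iterationPath_iterates {d₁ d₂ : ℕ} [NeZero d₁] {𝒲 : Type*} [MeasurableSpace 𝒲]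
    {d : Measure 𝒲} {α β : ℕ → ℝ} (hlr : LearningRates α β)
    {H Hinf bH : Euc d₁ → Euc d₂ → 𝒲 → Euc d₁} {G Ginf : Euc d₁ → Euc d₂ → 𝒲 → Euc d₂}
    {κH : ℝ → ℝ} {Lb L : 𝒲 → ℝ} (hH : ScalingLimit H Hinf κH bH Lb)
    (hHL : LipschitzIncrement d H Hinf L) (hGL : LipschitzIncrement d G Ginf L)
    (hL : Integrable L d)
    (hgas : IsGASEquilibrium (fun x => mean d Hinf x 0) 0) {w : ℕ → 𝒲}
    (hα : NoiseAverages d H G Lb L α w) (hβ : NoiseAverages d H G Lb L β w)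
    (x₀ : Euc d₁) (y₀ : Euc d₂) :
    IterationPath α β (fun i x y => H x y (w i)) (fun i x y => G x y (w i))
      (fun i x => Hinf x 0 (w i)) (fun x => mean d Hinf x 0) (fun i => L (w i))
      (fun i => Lb (w i)) κH (fastIter H G α β x₀ y₀ w) (slowIter H G α β x₀ y₀ w) where
  rates := hlr
  fast_step _ := rfl
  slow_step _ := rfl
  fast_lipschitz i x x' y y' := (hHL.lipschitz x x' y y' (w i)).trans
    (mul_le_mul_of_nonneg_left (pairNorm_le _ _) (nonneg_of_lipschitz hHL.lipschitz _))
  slow_lipschitz i x x' y y' := (hGL.lipschitz x x' y y' (w i)).trans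
    (mul_le_mul_of_nonneg_left (pairNorm_le _ _) (nonneg_of_lipschitz hHL.lipschitz _))
  limit_lipschitz i x x' := by
    simpa [pairNorm_zero_right] using hHL.lipschitz_limit x x' 0 0 (w i)
  const_nonneg i := nonneg_of_lipschitz hHL.lipschitz _
  scaling r hr i x := hH.norm_rescale_sub_le hr (w i) x
  scaling_const_nonneg i := nonneg_of_lipschitz hH.lipschitz _
  scaling_tendsto := hH.tendsto_zero
  limit_averages x := hH.averagesOut_limit hHL.integrable hα.fast x 0
  fast_averages := ⟨_, hα.fast 0 0⟩
  slow_averages := ⟨_, hβ.slow 0 0⟩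
  const_averages := ⟨_, hα.lipschitz⟩
  scaling_const_averages := ⟨_, hα.lipschitz_b⟩
  field_lipschitz := ⟨∫ w, L w ∂d,
    integral_nonneg fun w => nonneg_of_lipschitz hHL.lipschitz w, norm_mean_sub_le hHL hL⟩
  field_zero := hgas.equilibrium
  attractive := hgas.attractive

end TwoTimescale

theorem lemma3p1
    {Ω 𝒲 : Type*} [MeasurableSpace Ω] [MeasurableSpace 𝒲]
    (μ : Measure Ω) [IsProbabilityMeasure μ] {d₁ d₂ : ℕ}
    -- the noise: a Markov chain `W_1, W_2, …` with unique invariant probability measure `d`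
    (P : Kernel 𝒲 𝒲) [IsMarkovKernel P] (W : ℕ → Ω → 𝒲)
    (hW : TwoTimescale.IsMarkovChain μ P W)
    (d : Measure 𝒲) (hd : TwoTimescale.IsUniqueInvariant P d)
    -- the learning rates
    (α β : ℕ → ℝ) (hlr : TwoTimescale.LearningRates α β)
    -- the increment functions and their scaling limits
    (H Hinf bH : TwoTimescale.Euc d₁ → TwoTimescale.Euc d₂ → 𝒲 → TwoTimescale.Euc d₁)
    (G Ginf bG : TwoTimescale.Euc d₁ → TwoTimescale.Euc d₂ → 𝒲 → TwoTimescale.Euc d₂)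
    (κH κG : ℝ → ℝ) (Lb L : 𝒲 → ℝ)
    (hH : TwoTimescale.ScalingLimit H Hinf κH bH Lb)
    (hG : TwoTimescale.ScalingLimit G Ginf κG bG Lb)
    (hLb_meas : Measurable Lb) (hLb : Integrable Lb d)
    (hHL : TwoTimescale.LipschitzIncrement d H Hinf L)
    (hGL : TwoTimescale.LipschitzIncrement d G Ginf L)
    (hL_meas : Measurable L) (hL : Integrable L d)
    -- the mean ODEs
    (lam laminf : TwoTimescale.Euc d₂ → TwoTimescale.Euc d₁)
    (hode : TwoTimescale.ODEConditions (TwoTimescale.mean d H) (TwoTimescale.mean d Hinf)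
      (TwoTimescale.mean d G) (TwoTimescale.mean d Ginf) lam laminf)
    -- averaging of the noise, for all listed functions on one event of probability one
    (havg : ∀ᵐ ω ∂μ, TwoTimescale.NoiseAverages d H G Lb L α (fun i => W i ω) ∧
      TwoTimescale.NoiseAverages d H G Lb L β (fun i => W i ω))
    -- arbitrary, possibly random, initial iterates
    (x₀ : Ω → TwoTimescale.Euc d₁) (y₀ : Ω → TwoTimescale.Euc d₂) :
    ∀ᵐ ω ∂μ, ∃ K : ℝ, ∀ n m : ℕ,
      TwoTimescale.IsArgmaxNorm
        (TwoTimescale.slowIter H G α β (x₀ ω) (y₀ ω) (fun i => W i ω)) n m →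
      ‖TwoTimescale.fastIter H G α β (x₀ ω) (y₀ ω) (fun i => W i ω) n‖ ≤
        K * (1 + ‖TwoTimescale.slowIter H G α β (x₀ ω) (y₀ ω) (fun i => W i ω) m‖) := by
  filter_upwards [havg] with ω hω
  set y := TwoTimescale.slowIter H G α β (x₀ ω) (y₀ ω) (fun i => W i ω) with hy
  -- For `d₁ = 0` the fast iterate vanishes; otherwise a unit vector shows that the Lipschitz
  -- constants are nonnegative.
  rcases Nat.eq_zero_or_pos d₁ with rfl | hd₁
  · exact ⟨0, fun n m _ => by simp [Subsingleton.elim (TwoTimescale.fastIter _ _ _ _ _ _ _ n) 0]⟩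
  have : NeZero d₁ := ⟨hd₁.ne'⟩
  have hgas := (hode.fast_gas_limit 0).gas
  rw [hode.laminf_zero] at hgas
  have hP := TwoTimescale.iterationPath_iterates hlr hH hHL hGL hL hgas hω.1 hω.2 (x₀ ω) (y₀ ω)
  -- The running maximum is a monotone majorant, and any maximizer attains it, so ties do not
  -- matter.
  obtain ⟨K, hK0, hK⟩ := hP.exists_norm_le (D := fun n => 1 + partialSups (fun i => ‖y i‖) n)
    (fun i j hij => add_le_add le_rfl ((partialSups fun i => ‖y i‖).monotone hij))
    (fun n => add_le_add le_rfl (le_partialSups (fun i => ‖y i‖) n))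
  refine ⟨K, fun n m hm => (hK n).trans ?_⟩
  gcongr
  exact partialSups_le _ n _ fun i hi => hm.2 i hi
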